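/- Let $d\ge 1$, $1<\alpha_i<2$, $d_{i,\pm}\ge 0$ with $d_{i,+}+d_{i,-}>0$ for $1\le i\le d$, and put $$\mu:=\max_{1\le i\le d}\frac{|d_{i,+}-d_{i,-}|}{d_{i,+}+d_{i,-}}\left|\tan\left(\frac{\alpha_i}{2}\pi\right)\right| .$$ For a box $\prod_i(a_i,b_i)$, a time step $\tau>0$ and $\mathbf n=(n_1,\dots,n_d)$ with all $n_i\ge 1$, let $n=n_1\cdots n_d$, $\nu=1/\tau$, $h_i=(b_i-a_i)/(n_i+1)$, $v_{i,\pm}=d_{i,\pm}/(2h_i^{\alpha_i})$. Let $g_0^{(\alpha)}=1$, $g_k^{(\alpha)}=(1-\frac{\alpha+1}{k})g_{k-1}^{(\alpha)}$, $w_0^{(\alpha)}=\frac{\alpha}{2}g_0^{(\alpha)}$, $w_k^{(\alpha)}=\frac{\alpha}{2}g_k^{(\alpha)}+\frac{2-\alpha}{2}g_{k-1}^{(\alpha)}$ $(k\ge1)$, and let $L_m^{(\alpha)}\in\mathbb R^{m\times m}$ be the Toeplitz matrix with $(i,j)$ entry $-w_{i-j+1}^{(\alpha)}$ if $i-j+1\ge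 0$ and $0$ otherwise. With $W_i=I_{n_1\cdots n_{i-1}}\otimes L_{n_i}^{(\alpha_i)}\otimes I_{n_{i+1}\cdots n_d}$ define $$A_n=\nu I_n+\sum_{i=1}^d\left(v_{i,+}W_i+v_{i,-}W_i^{\top}\right),\qquad Y_n=Y_{n_1}\otimes\cdots\otimes Y_{n_d},$$ where $Y_m$ is the $m\times m$ anti-identity, and $$P_n=\nu I_n+\sum_{i=1}^d (v_{i,+}+v_{i,-})\, I_{n_1\cdots n_{i-1}}\otimes \tau\big(\mathcal H(L_{n_i}^{(\alpha_i)})\big)\otimes I_{n_{i+1}\cdots n_d},$$ where $\mathcal H(Z)=(Z+Z^\top)/2$ and, for a symmetric Toeplitz matrix $T_m$ with first column $(t_1,\dots,t_m)^\top$, $\tau(T_m)=T_m-H_m$ with $H_m$ the Hankel matrix with first column $(t_3,\dots,t_m,0,0)^\top$ and last column $(0,0,t_m,\dots,t_3)^\top$ ($H_m=0$ if $m\le2$). Then there is a constant $\epsilon$, depending only on $d$, $\alpha_i$, $d_{i,\pm}$ (and not on $\mathbf n$, $\tau$, or the box), with $0<\epsilon<\mu$ if $\mu>0$ and $\epsilon=0$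 if $\mu=0$, such that $$\omega:=\sqrt{\frac{2+3\epsilon}{4+3\epsilon}}\in\left[\sqrt{\tfrac12},1\right),\qquad \omega>\sqrt{\tfrac12}\ \text{ if }\mu>0,$$ and such that, for all boxes, all $\tau>0$ and all $\mathbf n$: the matrix $Y_nA_n$ is symmetric, $P_n$ is symmetric positive definite, all (complex) eigenvalues of $P_n^{-1}Y_nA_n$ are real and lie in $\left(-\frac32(1+\epsilon),-\frac12\right)\cup\left(\frac12,\frac32(1+\epsilon)\right)$, and, for every right-hand side $\mathbf b$, every initial guess $\mathbf u^{(0)}$ and every $k\ge0$, MINRES preconditioned by $P_n$ for $Y_nA_n\mathbf x=Y_n\mathbf b$ has residuals satisfying $$\|\mathbf r^{(k)}\|_{P_n}\le 2\,(\omega^2)^{\lfloor k/2\rfloor}\,\|\mathbf r^{(0)}\|_{P_n},\qquad \mathbf r^{(k)}=P_n^{-1}Y_n\mathbf b-P_n^{-1}Y_nA_n\mathbf u^{(k)} .$$ Here $\|\mathbf z\|_{P}=\sqrt{\mathbf z^\top P\mathbf z}=\|P^{1/2}\mathbf z\|_2$, so that $\|\mathbf r^{(k)}\|_{P_n}=\|Y_n\mathbf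 b-Y_nA_n\mathbf u^{(k)}\|_{P_n^{-1}}$, and the $k$-th iterate $\mathbf u^{(k)}$ is the minimizer of $\|Y_n\mathbf b-Y_nA_n\mathbf u\|_{P_n^{-1}}$ over $\mathbf u\in\mathbf u^{(0)}+\operatorname{span}\{(P_n^{-1}Y_nA_n)^j\mathbf r^{(0)}:0\le j<k\}$. -/

import Mathlib

open Matrix

namespace TauMinres

noncomputable section

/-- The Grünwald coefficients `g_k^{(α)}`. -/
def grunwaldCoeff (α : ℝ) : ℕ → ℝ
  | 0 => 1
  | k + 1 => (1 - (α + 1) / ((k : ℝ) + 1)) * grunwaldCoeff α k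

/-- The weighted and shifted Grünwald coefficients `w_k^{(α)}`. -/
def weightedCoeff (α : ℝ) : ℕ → ℝ
  | 0 => α / 2 * grunwaldCoeff α 0
  | k + 1 => α / 2 * grunwaldCoeff α (k + 1) + (2 - α) / 2 * grunwaldCoeff α k

/-- The lower Hessenberg Toeplitz matrix `L_m^{(α)}`, whose `(i, j)` entry is `-w_{i-j+1}` for
`i - j + 1 ≥ 0` and `0` otherwise. -/
def grunwaldMatrix (α : ℝ) (m : ℕ) : Matrix (Fin m) (Fin m) ℝ :=
  Matrix.of fun i j =>
    if (j : ℕ) ≤ (i : ℕ) + 1 then -weightedCoeff α ((i : ℕ) + 1 - (j : ℕ)) else 0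

/-- The anti-identity matrix `Y_m` (indices start at `0`). -/
def antiIdentity (m : ℕ) : Matrix (Fin m) (Fin m) ℝ :=
  Matrix.of fun i j => if (i : ℕ) + (j : ℕ) + 1 = m then 1 else 0

/-- The symmetric part `(Z + Zᵀ) / 2`. -/
def symPart {m : ℕ} (Z : Matrix (Fin m) (Fin m) ℝ) : Matrix (Fin m) (Fin m) ℝ :=
  (1 / 2 : ℝ) • (Z + Zᵀ)

/-- For a symmetric Toeplitz matrix `T` with first column `(t_1, …, t_m)`, the Hankel matrix with
first column `(t_3, …, t_m, 0, 0)` and last column `(0, 0, t_m, …, t_3)`. With indices starting at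
`0`, so that `T s 0 = t_{s+1}`, its antidiagonal `i + j = s` is constant, equal to `t_{s+3}` when
`s + 3 ≤ m`, to `t_{2m-s+1}` when `2m - s + 1 ≤ m`, and to `0` otherwise. -/
def hankelCorrection {m : ℕ} (T : Matrix (Fin m) (Fin m) ℝ) : Matrix (Fin m) (Fin m) ℝ :=
  Matrix.of fun i j =>
    if h : (i : ℕ) + (j : ℕ) + 2 < m then
      T ⟨(i : ℕ) + (j : ℕ) + 2, h⟩ ⟨0, by omega⟩
    else if h : 2 * m - ((i : ℕ) + (j : ℕ)) < m then
      T ⟨2 * m - ((i : ℕ) + (j : ℕ)), h⟩ ⟨0, by omega⟩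
    else 0

/-- The `τ`-matrix approximation of a symmetric Toeplitz matrix. -/
def tauMatrix {m : ℕ} (T : Matrix (Fin m) (Fin m) ℝ) : Matrix (Fin m) (Fin m) ℝ :=
  T - hankelCorrection T

/-- The index set of grid points of a `d`-dimensional grid with `n i` interior points along
direction `i`. It has `n_1 ⋯ n_d` elements. -/
abbrev Grid {d : ℕ} (n : Fin d → ℕ) : Type := (i : Fin d) → Fin (n i)

/-- The Kronecker product `M_1 ⊗ ⋯ ⊗ M_d`, indexed by multi-indices. -/
def kron {d : ℕ} {n : Fin d → ℕ} (M : (i : Fin d) → Matrix (Fin (n i)) (Fin (n i)) ℝ) :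
    Matrix (Grid n) (Grid n) ℝ :=
  Matrix.of fun x y => ∏ i, M i (x i) (y i)

/-- `I_{n_1 ⋯ n_{i-1}} ⊗ L ⊗ I_{n_{i+1} ⋯ n_d}`. -/
def axisMatrix {d : ℕ} (n : Fin d → ℕ) (i : Fin d) (L : Matrix (Fin (n i)) (Fin (n i)) ℝ) :
    Matrix (Grid n) (Grid n) ℝ :=
  kron (Function.update (fun j => (1 : Matrix (Fin (n j)) (Fin (n j)) ℝ)) i L)

/-- `Y_n = Y_{n_1} ⊗ ⋯ ⊗ Y_{n_d}`. -/
def multiAntiIdentity {d : ℕ} (n : Fin d → ℕ) : Matrix (Grid n) (Grid n) ℝ :=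
  kron fun i => antiIdentity (n i)

/-- `D / (2 h^α)`, with step size `h = (b - a) / (m + 1)`: the scaled diffusion coefficient. -/
def scaledCoeff (D α a b : ℝ) (m : ℕ) : ℝ :=
  D / (2 * ((b - a) / ((m : ℝ) + 1)) ^ α)

/-- The coefficient matrix `A_n = ν I_n + ∑ i, (v_{i,+} W_i + v_{i,-} W_iᵀ)`, where
`W_i = I ⊗ L_{n_i}^{(α_i)} ⊗ I`. -/
def systemMatrix {d : ℕ} (ν : ℝ) (α dp dm a b : Fin d → ℝ) (n : Fin d → ℕ) :
    Matrix (Grid n) (Grid n) ℝ :=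
  ν • (1 : Matrix (Grid n) (Grid n) ℝ) +
    ∑ i, (scaledCoeff (dp i) (α i) (a i) (b i) (n i) •
            axisMatrix n i (grunwaldMatrix (α i) (n i)) +
          scaledCoeff (dm i) (α i) (a i) (b i) (n i) •
            (axisMatrix n i (grunwaldMatrix (α i) (n i)))ᵀ)

/-- The multilevel Tau preconditioner
`P_n = ν I_n + ∑ i, (v_{i,+} + v_{i,-}) I ⊗ τ(H(L_{n_i}^{(α_i)})) ⊗ I`. -/
def tauPreconditioner {d : ℕ} (ν : ℝ) (α dp dm a b : Fin d → ℝ) (n : Fin d → ℕ) :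
    Matrix (Grid n) (Grid n) ℝ :=
  ν • (1 : Matrix (Grid n) (Grid n) ℝ) +
    ∑ i, (scaledCoeff (dp i) (α i) (a i) (b i) (n i) +
          scaledCoeff (dm i) (α i) (a i) (b i) (n i)) •
        axisMatrix n i (tauMatrix (symPart (grunwaldMatrix (α i) (n i))))

/-- `max_i |d_{i,+} - d_{i,-}| / (d_{i,+} + d_{i,-}) · |tan(α_i π / 2)|`. -/
def asymmetry {d : ℕ} (α dp dm : Fin d → ℝ) : ℝ :=
  ⨆ i, |dp i - dm i| / (dp i + dm i) * |Real.tan (α i / 2 * Real.pi)|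

/-- `ω = √((2 + 3ε) / (4 + 3ε))`. -/
def rate (ε : ℝ) : ℝ := √((2 + 3 * ε) / (4 + 3 * ε))

section Minres

variable {ι : Type*} [Fintype ι] [DecidableEq ι]

/-- The residual `P⁻¹ c - P⁻¹ M u` of the preconditioned system `P⁻¹ M u = P⁻¹ c`. -/
def precResidual (M P : Matrix ι ι ℝ) (c u : ι → ℝ) : ι → ℝ :=
  P⁻¹ *ᵥ c - (P⁻¹ * M) *ᵥ u

/-- The energy norm `√(zᵀ P z) = ‖P^{1/2} z‖₂`. For `z = P⁻¹ r` it equals `√(rᵀ P⁻¹ r)`, the norm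
of the residual `r = c - M u` that preconditioned MINRES minimizes. -/
def energyNorm (P : Matrix ι ι ℝ) (z : ι → ℝ) : ℝ :=
  √(z ⬝ᵥ (P *ᵥ z))

/-- The Krylov space `span {r, B r, …, B^{k-1} r}`. -/
def krylov (B : Matrix ι ι ℝ) (r : ι → ℝ) (k : ℕ) : Submodule ℝ (ι → ℝ) :=
  Submodule.span ℝ ((fun j : ℕ => (B ^ j) *ᵥ r) '' Set.Iio k)

/-- `u` is the `k`-th iterate of MINRES with preconditioner `P` for the symmetric system `M x = c`
with initial guess `u₀`: it minimizes the residual, in the norm `‖c - M y‖_{P⁻¹}`, over all `y` in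
`u₀ + K_k(P⁻¹ M, P⁻¹ (c - M u₀))`. -/
def IsMinresIterate (M P : Matrix ι ι ℝ) (c u₀ : ι → ℝ) (k : ℕ) (u : ι → ℝ) : Prop :=
  u - u₀ ∈ krylov (P⁻¹ * M) (precResidual M P c u₀) k ∧
    ∀ y : ι → ℝ, y - u₀ ∈ krylov (P⁻¹ * M) (precResidual M P c u₀) k →
      energyNorm P (precResidual M P c u) ≤ energyNorm P (precResidual M P c y)

open scoped MatrixOrder Matrix.Norms.L2Operator in
/-- MINRES iterates exist. -/
theorem exists_isMinresIterate (M P : Matrix ι ι ℝ) (hP : P.PosDef) (c u₀ : ι → ℝ) (k : ℕ) :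
    ∃ u, IsMinresIterate M P c u₀ k u := by
  obtain ⟨B, hB⟩ := CStarAlgebra.nonneg_iff_eq_star_mul_self.mp hP.posSemidef.nonneg
  rw [Matrix.star_eq_conjTranspose] at hB
  have hE : ∀ z : ι → ℝ, energyNorm P z = ‖WithLp.toLp 2 (B *ᵥ z)‖ := by
    intro z
    rw [EuclideanSpace.norm_eq, energyNorm, hB]
    congr 1
    rw [← Matrix.mulVec_mulVec, Matrix.dotProduct_mulVec, Matrix.conjTranspose_eq_transpose_of_trivial,
      Matrix.vecMul_transpose]
    simp [dotProduct, sq]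
  set K := krylov (P⁻¹ * M) (precResidual M P c u₀) k
  let φ : (ι → ℝ) →ₗ[ℝ] EuclideanSpace ℝ ι :=
    (WithLp.linearEquiv 2 ℝ (ι → ℝ)).symm.toLinearMap ∘ₗ (Matrix.mulVecLin (B * (P⁻¹ * M)))
  have hφ : ∀ y, WithLp.toLp 2 (B *ᵥ precResidual M P c (u₀ + y)) =
      WithLp.toLp 2 (B *ᵥ precResidual M P c u₀) - φ y := by
    intro y
    have : φ y = WithLp.toLp 2 ((B * (P⁻¹ * M)) *ᵥ y) := rfl
    rw [this, ← WithLp.toLp_sub]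
    congr 1
    simp only [precResidual, Matrix.mulVec_add, Matrix.mulVec_sub, ← Matrix.mulVec_mulVec]
    abel
  obtain ⟨s, hs, hmin⟩ := Submodule.exists_norm_eq_iInf_of_complete_subspace (K.map φ)
    (Submodule.complete_of_finiteDimensional _) (WithLp.toLp 2 (B *ᵥ precResidual M P c u₀))
  obtain ⟨y, hy, rfl⟩ := hs
  refine ⟨u₀ + y, by simpa using hy, fun z hz => ?_⟩
  have hz' : precResidual M P c z = precResidual M P c (u₀ + (z - u₀)) := by congr 1; abel
  rw [hE, hE, hz', hφ, hφ, hmin]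
  exact ciInf_le ⟨0, by rintro _ ⟨w, rfl⟩; exact norm_nonneg _⟩
    (⟨φ (z - u₀), Submodule.mem_map_of_mem hz⟩ : K.map φ)

end Minres

end

end TauMinres

/-!
Reversing the order of the grid points transposes a Toeplitz matrix, so `Y A` is symmetric; it
leaves the tau matrix unchanged, so `Y` commutes with `P`. For a symmetric Toeplitz matrix `T` with
Hankel correction `H`, the signs and the monotonicity of the Grünwald weights make `T + H` and
`T - 3 H` diagonally dominant, that is, `τ(T) / 2 ≤ T ≤ 3 τ(T) / 2`; hence `P / 2 < A < 3 P / 2` as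
quadratic forms. The closed form of the generating function of the weights places the numerical
range of each `L` in the sector `|Im z| ≤ |tan (α π / 2)| Re z`, so that of `A` lies in
`|Im z| ≤ μ Re z`.

If `Y A x = λ P x`, then `A x = λ P Y x`. Pairing this with `x` gives `1 / 2 < |λ|`. Pairing it with
`Y x` and using `(yᵀ A x)² ≤ (1 + μ²) (yᵀ A y) (xᵀ A x)`, a Cauchy–Schwarz inequality for sectorial
forms, gives `|λ| < 3 / 2 √(1 + μ²)`, so that `ε = √(1 + μ²) - 1`. A Chebyshev polynomial in `λ²`
then bounds the MINRES residuals.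
-/

namespace TauMinres

open Finset

section Coefficients

variable {α : ℝ}

theorem succ_mul_grunwaldCoeff_succ (α : ℝ) (k : ℕ) :
    (k + 1) * grunwaldCoeff α (k + 1) = (k - α) * grunwaldCoeff α k := by
  rw [grunwaldCoeff]
  have : (k : ℝ) + 1 ≠ 0 := by positivity
  field_simp
  ring

theorem grunwaldCoeff_two (α : ℝ) : grunwaldCoeff α 2 = α * (α - 1) / 2 := by
  simp only [grunwaldCoeff]
  push_cast
  ring

theorem grunwaldCoeff_add_two_nonneg (h₁ : 1 ≤ α) (h₂ : α ≤ 2) (k : ℕ) :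
    0 ≤ grunwaldCoeff α (k + 2) := by
  induction k with
  | zero => rw [grunwaldCoeff_two]; nlinarith
  | succ k ih =>
    refine mul_nonneg ?_ ih
    rw [sub_nonneg, div_le_one (by positivity)]
    push_cast
    linarith [(Nat.cast_nonneg k : (0 : ℝ) ≤ k)]

theorem grunwaldCoeff_add_two_antitone (h₁ : 1 ≤ α) (h₂ : α ≤ 2) :
    Antitone fun k => grunwaldCoeff α (k + 2) := by
  refine antitone_nat_of_succ_le fun k => mul_le_of_le_one_left
    (grunwaldCoeff_add_two_nonneg h₁ h₂ k) (sub_le_self 1 (by positivity))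

theorem mul_sum_grunwaldCoeff (α : ℝ) (m : ℕ) :
    α * ∑ k ∈ range (m + 1), grunwaldCoeff α k = -((m + 1) * grunwaldCoeff α (m + 1)) := by
  induction m with
  | zero => simp [grunwaldCoeff]
  | succ m ih =>
    rw [sum_range_succ, mul_add, ih, succ_mul_grunwaldCoeff_succ α (m + 1)]
    push_cast
    ring

theorem sum_grunwaldCoeff_nonpos (h₁ : 1 ≤ α) (h₂ : α ≤ 2) (m : ℕ) :
    ∑ k ∈ range (m + 2), grunwaldCoeff α k ≤ 0 := by
  refine nonpos_of_mul_nonpos_right ?_ (zero_lt_one.trans_le h₁)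
  rw [mul_sum_grunwaldCoeff, neg_nonpos]
  exact mul_nonneg (by positivity) (grunwaldCoeff_add_two_nonneg h₁ h₂ m)

theorem sum_weightedCoeff (α : ℝ) (m : ℕ) :
    ∑ k ∈ range (m + 1), weightedCoeff α k =
      α / 2 * ∑ k ∈ range (m + 1), grunwaldCoeff α k +
        (2 - α) / 2 * ∑ k ∈ range m, grunwaldCoeff α k := by
  simp only [sum_range_succ', weightedCoeff, sum_add_distrib, mul_add, mul_sum]
  ring

theorem sum_weightedCoeff_nonpos (h₁ : 1 ≤ α) (h₂ : α ≤ 2) (m : ℕ) :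
    ∑ k ∈ range (m + 3), weightedCoeff α k ≤ 0 := by
  rw [sum_weightedCoeff]
  exact add_nonpos
    (mul_nonpos_of_nonneg_of_nonpos (by linarith) (sum_grunwaldCoeff_nonpos h₁ h₂ (m + 1)))
    (mul_nonpos_of_nonneg_of_nonpos (by linarith) (sum_grunwaldCoeff_nonpos h₁ h₂ m))

theorem weightedCoeff_add_three_nonneg (h₁ : 1 ≤ α) (h₂ : α ≤ 2) (k : ℕ) :
    0 ≤ weightedCoeff α (k + 3) :=
  add_nonneg (mul_nonneg (by linarith) (grunwaldCoeff_add_two_nonneg h₁ h₂ (k + 1)))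
    (mul_nonneg (by linarith) (grunwaldCoeff_add_two_nonneg h₁ h₂ k))

theorem weightedCoeff_add_three_antitone (h₁ : 1 ≤ α) (h₂ : α ≤ 2) :
    Antitone fun k => weightedCoeff α (k + 3) := fun k l hkl =>
  add_le_add
    (mul_le_mul_of_nonneg_left (grunwaldCoeff_add_two_antitone h₁ h₂ (Nat.succ_le_succ hkl))
      (by linarith))
    (mul_le_mul_of_nonneg_left (grunwaldCoeff_add_two_antitone h₁ h₂ hkl) (by linarith))

/-- The first column of the symmetric Toeplitz matrix `symPart (grunwaldMatrix α m)`, with indices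
starting at `0`. -/
noncomputable def symCoeff (α : ℝ) : ℕ → ℝ
  | 0 => -weightedCoeff α 1
  | 1 => -((weightedCoeff α 0 + weightedCoeff α 2) / 2)
  | l + 2 => -(weightedCoeff α (l + 3) / 2)

theorem symCoeff_zero (α : ℝ) : symCoeff α 0 = (α - 1) * (α + 2) / 2 := by
  simp only [symCoeff, weightedCoeff, grunwaldCoeff]
  push_cast
  ring

theorem symCoeff_one (α : ℝ) : symCoeff α 1 = -(α * (α - 1) * (α + 2) / 8) := by
  simp only [symCoeff, weightedCoeff, grunwaldCoeff]
  push_cast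
  ring

theorem symCoeff_two (α : ℝ) :
    symCoeff α 2 = -(α * (α - 1) * ((2 - α) * (α + 3)) / 24) := by
  simp only [symCoeff, weightedCoeff, grunwaldCoeff]
  push_cast
  ring

theorem symCoeff_succ_nonpos (h₁ : 1 ≤ α) (h₂ : α ≤ 2) : ∀ l, symCoeff α (l + 1) ≤ 0
  | 0 => by
    have : 0 ≤ α * (α - 1) * (α + 2) :=
      mul_nonneg (mul_nonneg (by linarith) (by linarith)) (by linarith)
    rw [symCoeff_one]
    linarith
  | l + 1 => neg_nonpos.2 (div_nonneg (weightedCoeff_add_three_nonneg h₁ h₂ l) zero_le_two)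

theorem symCoeff_succ_monotone (h₁ : 1 ≤ α) (h₂ : α ≤ 2) :
    Monotone fun l => symCoeff α (l + 1) := by
  refine monotone_nat_of_le_succ fun l => ?_
  rcases l with _ | l
  · have : 0 ≤ α * (α - 1) := mul_nonneg (by linarith) (by linarith)
    rw [symCoeff_one, symCoeff_two]
    nlinarith [mul_nonneg this (by nlinarith : 0 ≤ 3 * (α + 2) - (2 - α) * (α + 3))]
  · exact neg_le_neg (div_le_div_of_nonneg_right
      (weightedCoeff_add_three_antitone h₁ h₂ l.le_succ) zero_le_two)

theorem symCoeff_zero_add_two_mul_sum (α : ℝ) (m : ℕ) :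
    symCoeff α 0 + 2 * ∑ l ∈ range (m + 1), symCoeff α (l + 1) =
      -∑ k ∈ range (m + 3), weightedCoeff α k := by
  rw [sum_range_succ', sum_range_succ', sum_range_succ', sum_range_succ']
  simp only [symCoeff, sum_neg_distrib, ← sum_div]
  ring

theorem symCoeff_zero_add_two_mul_sum_nonneg (h₁ : 1 ≤ α) (h₂ : α ≤ 2) (m : ℕ) :
    0 ≤ symCoeff α 0 + 2 * ∑ l ∈ range m, symCoeff α (l + 1) := by
  rcases m with _ | m
  · rw [sum_range_zero, symCoeff_zero]
    nlinarith
  · rw [symCoeff_zero_add_two_mul_sum]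
    exact neg_nonneg.2 (sum_weightedCoeff_nonpos h₁ h₂ m)

end Coefficients

section DiagonalDominance

variable {ι : Type*} [Fintype ι]

theorem posSemidef_of_sum_erase_abs_le_diag [DecidableEq ι] {A : Matrix ι ι ℝ} (hA : A.IsSymm)
    (h : ∀ i, ∑ j ∈ univ.erase i, |A i j| ≤ A i i) : A.PosSemidef := by
  have hA' : A.IsHermitian := Matrix.isHermitian_iff_isSymm.2 hA
  refine hA'.posSemidef_iff_eigenvalues_nonneg.2 fun i => ?_
  have hev : Module.End.HasEigenvalue (toLin' A) (hA'.eigenvalues i) := by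
    rw [Module.End.hasEigenvalue_iff_mem_spectrum, spectrum_toLin']
    exact hA'.eigenvalues_mem_spectrum_real i
  obtain ⟨k, hk⟩ := eigenvalue_mem_ball hev
  simp only [Metric.mem_closedBall, Real.dist_eq, Real.norm_eq_abs] at hk
  have := (abs_le.1 (hk.trans (h k))).1
  exact (by linarith : 0 ≤ hA'.eigenvalues i)

theorem posSemidef_of_abs_le_neg_of_sum_nonneg {A B : Matrix ι ι ℝ} (hA : A.IsSymm)
    (hdiag : ∀ i, B i i ≤ A i i) (hoff : ∀ i j, i ≠ j → |A i j| ≤ -B i j)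
    (hsum : ∀ i, 0 ≤ ∑ j, B i j) : A.PosSemidef := by
  classical
  refine posSemidef_of_sum_erase_abs_le_diag hA fun i => ?_
  have hi := hsum i
  rw [← add_sum_erase _ _ (mem_univ i)] at hi
  calc ∑ j ∈ univ.erase i, |A i j| ≤ ∑ j ∈ univ.erase i, -B i j :=
        sum_le_sum fun j hj => hoff i j (ne_of_mem_erase hj).symm
    _ ≤ B i i := by rw [sum_neg_distrib]; linarith
    _ ≤ A i i := hdiag i

end DiagonalDominance

section SymmetricToeplitz

variable {m : ℕ}

/-- The symmetric Toeplitz matrix with first column `t 0, …, t (m - 1)`. As the subtractions are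
truncated, the argument of `t` is `|i - j|`. -/
def symmToeplitz (t : ℕ → ℝ) (m : ℕ) : Matrix (Fin m) (Fin m) ℝ :=
  Matrix.of fun i j => t (((i : ℕ) - j) + (j - i))

theorem symmToeplitz_isSymm (t : ℕ → ℝ) (m : ℕ) : (symmToeplitz t m).IsSymm := by
  ext i j
  simp only [symmToeplitz, transpose_apply, of_apply, add_comm ((j : ℕ) - i)]

theorem hankelCorrection_isSymm (T : Matrix (Fin m) (Fin m) ℝ) : (hankelCorrection T).IsSymm := by
  ext i j
  simp only [transpose_apply, hankelCorrection, of_apply, add_comm (j : ℕ)]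

theorem tauMatrix_isSymm {T : Matrix (Fin m) (Fin m) ℝ} (hT : T.IsSymm) : (tauMatrix T).IsSymm :=
  hT.sub (hankelCorrection_isSymm T)

theorem symmToeplitz_rev (t : ℕ → ℝ) (i j : Fin m) :
    symmToeplitz t m i.rev j.rev = symmToeplitz t m i j := by
  simp only [symmToeplitz, of_apply, Fin.val_rev]
  congr 1
  omega

theorem hankelCorrection_rev (T : Matrix (Fin m) (Fin m) ℝ) (i j : Fin m) :
    hankelCorrection T i.rev j.rev = hankelCorrection T i j := by
  simp only [hankelCorrection, of_apply, Fin.val_rev]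
  split_ifs <;> first | omega | rfl | (congr 2; omega)

theorem tauMatrix_symmToeplitz_rev (t : ℕ → ℝ) (i j : Fin m) :
    tauMatrix (symmToeplitz t m) i.rev j.rev = tauMatrix (symmToeplitz t m) i j := by
  simp only [tauMatrix, Matrix.sub_apply, symmToeplitz_rev, hankelCorrection_rev]

variable {t : ℕ → ℝ}

theorem hankelCorrection_symmToeplitz_nonpos (ht : ∀ l, t (l + 1) ≤ 0) (i j : Fin m) :
    hankelCorrection (symmToeplitz t m) i j ≤ 0 := by
  have ht' {l : ℕ} (hl : 0 < l) : t l ≤ 0 := by simpa [Nat.sub_add_cancel hl] using ht (l - 1)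
  simp only [hankelCorrection, symmToeplitz, of_apply]
  split_ifs
  · exact ht' (by omega)
  · exact ht' (by omega)
  · rfl

/-- In both corners of the Hankel matrix the nonzero entries are `t l` with `|i - j| < l`. -/
theorem symmToeplitz_le_hankelCorrection (ht : ∀ l, t (l + 1) ≤ 0)
    (hmono : Monotone fun l => t (l + 1)) {i j : Fin m} (hij : i ≠ j) :
    symmToeplitz t m i j ≤ hankelCorrection (symmToeplitz t m) i j := by
  have hij' : (i : ℕ) ≠ j := Fin.val_ne_of_ne hij
  obtain ⟨k, hk⟩ : ∃ k, ((i : ℕ) - j) + (j - i) = k + 1 :=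
    Nat.exists_eq_add_one.2 (by omega)
  have hmono' {l : ℕ} (hl : k < l) : t (k + 1) ≤ t l := by
    simpa [Nat.sub_add_cancel (Nat.zero_lt_of_lt hl)] using hmono (Nat.le_sub_one_of_lt hl)
  simp only [hankelCorrection, symmToeplitz, of_apply, hk]
  split_ifs
  · exact hmono' (by omega)
  · exact hmono' (by omega)
  · exact ht k

theorem sum_range_le_sum_halfRow (ht : ∀ l, t (l + 1) ≤ 0) {i : ℕ} (hi : i < m) :
    ∑ l ∈ range m, t (l + 1) ≤ ∑ j ∈ range m,
      ((if j < i then t (i - j) else 0) + if i + j + 2 < m then t (i + j + 2) else 0) := by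
  have hT : ∑ j ∈ range m, (if j < i then t (i - j) else 0) = ∑ l ∈ range i, t (l + 1) := by
    rw [← sum_filter, show {j ∈ range m | j < i} = range i by
        ext
        simp only [mem_filter, mem_range]
        omega,
      ← sum_range_reflect]
    refine sum_congr rfl fun j hj => congrArg t ?_
    have := mem_range.1 hj
    omega
  have hH : ∑ j ∈ range m, (if i + j + 2 < m then t (i + j + 2) else 0) =
      ∑ l ∈ Ico (i + 1) (m - 1), t (l + 1) := by
    rw [← sum_filter, sum_Ico_eq_sum_range,
      show {j ∈ range m | i + j + 2 < m} = range (m - 1 - (i + 1)) by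
        ext
        simp only [mem_filter, mem_range]
        omega]
    exact sum_congr rfl fun j _ => congrArg t (by omega)
  have hdisj : Disjoint (range i) (Ico (i + 1) (m - 1)) :=
    disjoint_left.2 fun l => by
      simp only [mem_range, mem_Ico]
      omega
  rw [sum_add_distrib, hT, hH, ← sum_union hdisj]
  refine sum_le_sum_of_subset_of_nonpos' (fun l => ?_) fun l _ _ => ht l
  simp only [mem_union, mem_range, mem_Ico]
  omega

/-- Left of the diagonal the Toeplitz row and the upper left Hankel corner have pairwise distinct
arguments of `t`; so do, by reflection, the row right of the diagonal and the lower right corner. -/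
theorem sum_symmToeplitz_add_hankelCorrection_nonneg (ht : ∀ l, t (l + 1) ≤ 0)
    (hsum : ∀ m, 0 ≤ t 0 + 2 * ∑ l ∈ range m, t (l + 1)) (i : Fin m) :
    0 ≤ ∑ j, (symmToeplitz t m + hankelCorrection (symmToeplitz t m)) i j := by
  let halfRow (i j : Fin m) : ℝ :=
    (if j < i then t (i - j) else 0) + if (i : ℕ) + j + 2 < m then t (i + j + 2) else 0
  have hhalf (i : Fin m) : ∑ l ∈ range m, t (l + 1) ≤ ∑ j, halfRow i j := by
    simp only [halfRow, Fin.lt_def]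
    rw [Fin.sum_univ_eq_sum_range (fun j => (if j < (i : ℕ) then t (i - j) else 0) +
      if (i : ℕ) + j + 2 < m then t (i + j + 2) else 0)]
    exact sum_range_le_sum_halfRow ht i.2
  have hsplit (j : Fin m) : symmToeplitz t m i j + hankelCorrection (symmToeplitz t m) i j =
      (if j = i then t 0 else 0) + (halfRow i j + halfRow i.rev j.rev) := by
    have hi := i.2
    have hj := j.2
    have hT : symmToeplitz t m i j = (if j = i then t 0 else 0) +
        ((if j < i then t (i - j) else 0) + if j.rev < i.rev then t (i.rev - j.rev) else 0) := by
      simp only [symmToeplitz, of_apply, Fin.ext_iff, Fin.lt_def, Fin.val_rev]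
      grind
    have hH : hankelCorrection (symmToeplitz t m) i j =
        (if (i : ℕ) + j + 2 < m then t (i + j + 2) else 0) +
          if (i.rev : ℕ) + j.rev + 2 < m then t (i.rev + j.rev + 2) else 0 := by
      simp only [symmToeplitz, hankelCorrection, of_apply, Fin.val_rev]
      grind
    rw [hT, hH]
    ring
  have hrev : ∑ j : Fin m, halfRow i.rev j.rev = ∑ j, halfRow i.rev j :=
    Equiv.sum_comp Fin.revPerm (halfRow i.rev)
  simp only [Matrix.add_apply, hsplit, sum_add_distrib, sum_ite_eq', mem_univ, if_true, hrev]
  linarith [hsum m, hhalf i, hhalf i.rev]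

theorem symmToeplitz_add_hankelCorrection_posSemidef (ht : ∀ l, t (l + 1) ≤ 0)
    (hmono : Monotone fun l => t (l + 1)) (hsum : ∀ m, 0 ≤ t 0 + 2 * ∑ l ∈ range m, t (l + 1))
    (m : ℕ) : (symmToeplitz t m + hankelCorrection (symmToeplitz t m)).PosSemidef := by
  refine posSemidef_of_abs_le_neg_of_sum_nonneg
    ((symmToeplitz_isSymm t m).add (hankelCorrection_isSymm _)) (fun i => le_rfl)
    (fun i j hij => ?_) (sum_symmToeplitz_add_hankelCorrection_nonneg ht hsum)
  have hle := symmToeplitz_le_hankelCorrection ht hmono hij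
  have hH := hankelCorrection_symmToeplitz_nonpos ht i j
  rw [Matrix.add_apply, abs_of_nonpos (by linarith)]

theorem symmToeplitz_sub_hankelCorrection_posSemidef (ht : ∀ l, t (l + 1) ≤ 0)
    (hmono : Monotone fun l => t (l + 1)) (hsum : ∀ m, 0 ≤ t 0 + 2 * ∑ l ∈ range m, t (l + 1))
    (m : ℕ) : (symmToeplitz t m - (3 : ℝ) • hankelCorrection (symmToeplitz t m)).PosSemidef := by
  refine posSemidef_of_abs_le_neg_of_sum_nonneg
    ((symmToeplitz_isSymm t m).sub ((hankelCorrection_isSymm _).smul 3)) (fun i => ?_)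
    (fun i j hij => ?_) (sum_symmToeplitz_add_hankelCorrection_nonneg ht hsum)
  · have hH := hankelCorrection_symmToeplitz_nonpos ht i i
    simp only [Matrix.sub_apply, Matrix.add_apply, Matrix.smul_apply, smul_eq_mul]
    linarith
  · have hle := symmToeplitz_le_hankelCorrection ht hmono hij
    have hH := hankelCorrection_symmToeplitz_nonpos ht i j
    simp only [Matrix.sub_apply, Matrix.add_apply, Matrix.smul_apply, smul_eq_mul, abs_le]
    constructor <;> linarith

theorem tauMatrix_symmToeplitz_form_bounds (ht : ∀ l, t (l + 1) ≤ 0)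
    (hmono : Monotone fun l => t (l + 1)) (hsum : ∀ m, 0 ≤ t 0 + 2 * ∑ l ∈ range m, t (l + 1))
    (x : Fin m → ℝ) :
    1 / 2 * (x ⬝ᵥ (tauMatrix (symmToeplitz t m) *ᵥ x)) ≤ x ⬝ᵥ (symmToeplitz t m *ᵥ x) ∧
      x ⬝ᵥ (symmToeplitz t m *ᵥ x) ≤ 3 / 2 * (x ⬝ᵥ (tauMatrix (symmToeplitz t m) *ᵥ x)) := by
  have hadd :=
    (symmToeplitz_add_hankelCorrection_posSemidef ht hmono hsum m).dotProduct_mulVec_nonneg x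
  have hsub :=
    (symmToeplitz_sub_hankelCorrection_posSemidef ht hmono hsum m).dotProduct_mulVec_nonneg x
  simp only [star_trivial, tauMatrix, sub_mulVec, add_mulVec, smul_mulVec, dotProduct_add,
    dotProduct_sub, dotProduct_smul, smul_eq_mul] at hadd hsub ⊢
  constructor <;> linarith

end SymmetricToeplitz

section GrunwaldMatrix

variable {m : ℕ}

theorem symPart_isSymm (Z : Matrix (Fin m) (Fin m) ℝ) : (symPart Z).IsSymm := by
  simp only [Matrix.IsSymm, symPart, transpose_smul, transpose_add, transpose_transpose, add_comm]

theorem symPart_grunwaldMatrix (α : ℝ) (m : ℕ) :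
    symPart (grunwaldMatrix α m) = symmToeplitz (symCoeff α) m := by
  ext i j
  wlog hij : j ≤ i generalizing i j
  · rw [← (symPart_isSymm _).apply, ← (symmToeplitz_isSymm _ _).apply]
    exact this j i (le_of_not_ge hij)
  obtain ⟨c, hc⟩ := Nat.exists_eq_add_of_le (Fin.le_def.1 hij)
  simp only [symPart, grunwaldMatrix, symmToeplitz, Matrix.smul_apply, Matrix.add_apply, of_apply,
    transpose_apply, smul_eq_mul, hc, add_tsub_cancel_left, Nat.sub_eq_zero_of_le, Nat.le_add_right]
  rcases c with _ | _ | c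
  · simp only [symCoeff, add_zero, le_add_iff_nonneg_right, zero_le, ↓reduceIte,
      add_tsub_cancel_left]
    ring
  · simp only [symCoeff, zero_add, add_assoc, Nat.reduceAdd, le_add_iff_nonneg_right, zero_le,
      ↓reduceIte, add_tsub_cancel_left, le_refl, tsub_self]
    ring
  · simp only [symCoeff, add_assoc, Nat.reduceAdd, le_add_iff_nonneg_right, zero_le, ↓reduceIte,
      add_tsub_cancel_left, add_le_add_iff_left, Nat.reduceLeDiff, add_zero]
    ring

theorem grunwaldMatrix_rev (α : ℝ) (i j : Fin m) :
    grunwaldMatrix α m i.rev j.rev = grunwaldMatrix α m j i := by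
  simp only [grunwaldMatrix, of_apply, Fin.val_rev]
  split_ifs <;> first | omega | rfl | (congr 2; omega)

end GrunwaldMatrix

section GeneratingFunction

variable {α : ℝ}

theorem summable_grunwaldCoeff (h₁ : 1 ≤ α) (h₂ : α ≤ 2) : Summable (grunwaldCoeff α) := by
  rw [← summable_nat_add_iff 2]
  refine summable_of_sum_range_le (c := α - 1) (grunwaldCoeff_add_two_nonneg h₁ h₂) fun m => ?_
  have hone : grunwaldCoeff α 1 = -α := by simp [grunwaldCoeff]
  have h := sum_grunwaldCoeff_nonpos h₁ h₂ m
  rw [sum_range_succ', sum_range_succ', zero_add, hone, grunwaldCoeff] at h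
  linarith

theorem summable_norm_grunwaldCoeff (h₁ : 1 ≤ α) (h₂ : α ≤ 2) :
    Summable fun k => ‖(grunwaldCoeff α k : ℂ)‖ := by
  simpa using (summable_grunwaldCoeff h₁ h₂).abs

theorem grunwaldCoeff_eq_choose (α : ℝ) (k : ℕ) :
    (grunwaldCoeff α k : ℂ) = (-1) ^ k * Ring.choose (α : ℂ) k := by
  induction k with
  | zero => simp [grunwaldCoeff]
  | succ k ih =>
    have hg : ((k : ℂ) + 1) * grunwaldCoeff α (k + 1) = (k - α) * grunwaldCoeff α k := by
      exact_mod_cast succ_mul_grunwaldCoeff_succ α k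
    have hchoose := Ring.choose_smul_choose (α : ℂ) (Nat.le_succ k)
    simp only [Nat.succ_eq_add_one, Nat.choose_succ_self_right, Nat.add_sub_cancel_left,
      Ring.choose_one_right, nsmul_eq_mul] at hchoose
    push_cast at hchoose
    apply mul_left_cancel₀ (Nat.cast_add_one_ne_zero k : (k : ℂ) + 1 ≠ 0)
    rw [hg, ih, pow_succ]
    linear_combination (-1 : ℂ) ^ k * hchoose

theorem hasSum_grunwaldCoeff_of_norm_lt_one (α : ℝ) {z : ℂ} (hz : ‖z‖ < 1) :
    HasSum (fun k => (grunwaldCoeff α k : ℂ) * z ^ k) ((1 - z) ^ (α : ℂ)) := by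
  have h := (Complex.one_add_cpow_hasFPowerSeriesOnBall_zero (a := (α : ℂ))).hasSum
    (y := -z) (by rw [← ENNReal.ofReal_one, Metric.eball_ofReal]; simpa using hz)
  rw [zero_add, ← sub_eq_add_neg] at h
  refine h.congr_fun fun k => ?_
  rw [binomialSeries_apply, List.ofFn_const, List.prod_replicate, grunwaldCoeff_eq_choose,
    neg_pow, smul_eq_mul]
  ring

theorem continuousOn_one_sub_cpow (hα : 0 < α) :
    ContinuousOn (fun z : ℂ => (1 - z) ^ (α : ℂ)) (Metric.closedBall 0 1) := by
  intro z hz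
  have hre : 0 ≤ (1 - z).re := by
    simpa using (Complex.re_le_norm z).trans (by simpa using hz)
  exact (ContinuousAt.comp (f := fun z : ℂ => 1 - z)
    (Complex.continuousAt_cpow_const_of_re_pos (Or.inl hre) (by simpa using hα))
    (by fun_prop)).continuousWithinAt

theorem hasSum_grunwaldCoeff (h₁ : 1 ≤ α) (h₂ : α ≤ 2) {z : ℂ} (hz : ‖z‖ ≤ 1) :
    HasSum (fun k => (grunwaldCoeff α k : ℂ) * z ^ k) ((1 - z) ^ (α : ℂ)) := by
  have hg := summable_norm_grunwaldCoeff h₁ h₂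
  have hle : ∀ k, ∀ y ∈ Metric.closedBall (0 : ℂ) 1,
      ‖(grunwaldCoeff α k : ℂ) * y ^ k‖ ≤ ‖(grunwaldCoeff α k : ℂ)‖ := by
    intro k y hy
    rw [norm_mul, norm_pow]
    exact mul_le_of_le_one_right (norm_nonneg _)
      (pow_le_one₀ (norm_nonneg _) (by simpa using hy))
  have hmem : z ∈ Metric.closedBall (0 : ℂ) 1 := by simpa using hz
  have hcont : ContinuousOn (fun y : ℂ => ∑' k, (grunwaldCoeff α k : ℂ) * y ^ k)
      (Metric.closedBall 0 1) :=
    continuousOn_tsum (fun k => by fun_prop) hg hle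
  have heq : Set.EqOn (fun y : ℂ => ∑' k, (grunwaldCoeff α k : ℂ) * y ^ k)
      (fun y : ℂ => (1 - y) ^ (α : ℂ)) (Metric.closedBall 0 1) :=
    Set.EqOn.of_subset_closure (s := Metric.ball 0 1)
      (fun y hy => (hasSum_grunwaldCoeff_of_norm_lt_one α (by simpa using hy)).tsum_eq)
      hcont (continuousOn_one_sub_cpow (by linarith)) Metric.ball_subset_closedBall
      (by rw [closure_ball _ one_ne_zero])
  rw [← show _ = (1 - z) ^ (α : ℂ) from heq hmem]
  exact (Summable.of_norm_bounded hg fun k => hle k z hmem).hasSum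

theorem hasSum_weightedCoeff (h₁ : 1 ≤ α) (h₂ : α ≤ 2) {z : ℂ} (hz : ‖z‖ ≤ 1) :
    HasSum (fun k => (weightedCoeff α k : ℂ) * z ^ k)
      ((α / 2 + (2 - α) / 2 * z) * (1 - z) ^ (α : ℂ)) := by
  have h := hasSum_grunwaldCoeff h₁ h₂ hz
  have htail := (hasSum_nat_add_iff' 1).2 (h.mul_left ((α : ℂ) / 2))
  have hshift := h.mul_left ((2 - (α : ℂ)) / 2 * z)
  rw [← hasSum_nat_add_iff' 1]
  convert htail.add hshift using 1
  · ext k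
    simp only [weightedCoeff]
    push_cast
    ring
  · simp only [weightedCoeff, range_one, sum_singleton, pow_zero]
    push_cast
    ring

theorem summable_norm_weightedCoeff (h₁ : 1 ≤ α) (h₂ : α ≤ 2) :
    Summable fun k => ‖(weightedCoeff α k : ℂ)‖ := by
  rw [← summable_nat_add_iff 1]
  have h := summable_norm_grunwaldCoeff h₁ h₂
  refine Summable.of_nonneg_of_le (fun _ => norm_nonneg _) (fun k => ?_)
    ((((summable_nat_add_iff 1).2 h).mul_left ‖(α / 2 : ℂ)‖).add
      (h.mul_left ‖((2 - α) / 2 : ℂ)‖))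
  simp only [weightedCoeff]
  push_cast
  exact (norm_add_le _ _).trans_eq (by rw [norm_mul, norm_mul])

end GeneratingFunction

section ToeplitzForm

open scoped Real ComplexConjugate
open Complex (I)

theorem integral_exp_int_mul (n : ℤ) :
    ∫ θ in (0 : ℝ)..(2 * π), Complex.exp (n * (θ * I)) = if n = 0 then (2 * π : ℂ) else 0 := by
  split_ifs with hn
  · simp [hn]
  · have hc : (n : ℂ) * I ≠ 0 := mul_ne_zero (by exact_mod_cast hn) Complex.I_ne_zero
    have hperiod : (n : ℂ) * I * ((2 * π : ℝ) : ℂ) = n * (2 * π * I) := by push_cast; ring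
    simp_rw [show ∀ θ : ℝ, (n : ℂ) * (θ * I) = n * I * θ from fun θ => by ring]
    rw [integral_exp_mul_complex hc, hperiod, Complex.exp_int_mul_two_pi_mul_I]
    simp

theorem integral_exp_pow_mul_exp_neg (k : ℕ) (n : ℤ) :
    ∫ θ in (0 : ℝ)..(2 * π), Complex.exp (θ * I) ^ k * Complex.exp (-(n * (θ * I))) =
      if (k : ℤ) = n then (2 * π : ℂ) else 0 := by
  have hexp : ∀ θ : ℝ, Complex.exp (θ * I) ^ k * Complex.exp (-(n * (θ * I))) =
      Complex.exp ((k - n : ℤ) * (θ * I)) := by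
    intro θ
    rw [← Complex.exp_nat_mul, ← Complex.exp_add]
    congr 1
    push_cast
    ring
  simp only [hexp, integral_exp_int_mul, sub_eq_zero]

theorem integral_mul_exp_neg_of_hasSum {w : ℕ → ℂ} (hw : Summable fun k => ‖w k‖) {f : ℝ → ℂ}
    (hf : ∀ θ : ℝ, HasSum (fun k => w k * Complex.exp (θ * I) ^ k) (f θ)) (n : ℤ) :
    ∫ θ in (0 : ℝ)..(2 * π), f θ * Complex.exp (-(n * (θ * I))) =
      if 0 ≤ n then w n.toNat * (2 * π) else 0 := by
  have hnorm : ∀ θ : ℝ, ‖Complex.exp (-(n * (θ * I)))‖ = 1 := by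
    intro θ
    simpa [mul_assoc] using Complex.norm_exp_ofReal_mul_I (-(n * θ))
  have h := intervalIntegral.hasSum_integral_of_dominated_convergence
    (a := 0) (b := 2 * π) (μ := MeasureTheory.volume)
    (F := fun k θ => w k * (Complex.exp (θ * I) ^ k * Complex.exp (-(n * (θ * I)))))
    (f := fun θ => f θ * Complex.exp (-(n * (θ * I))))
    (fun k _ => ‖w k‖) (fun k => Continuous.aestronglyMeasurable (by fun_prop))
    (fun k => .of_forall fun θ _ => by
      rw [norm_mul, norm_mul, norm_pow, Complex.norm_exp_ofReal_mul_I, hnorm, one_pow, one_mul,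
        mul_one])
    (.of_forall fun θ _ => hw) intervalIntegrable_const
    (.of_forall fun θ _ => by simpa only [mul_assoc] using (hf θ).mul_right _)
  simp only [intervalIntegral.integral_const_mul, integral_exp_pow_mul_exp_neg, mul_ite,
    mul_zero] at h
  rw [← h.tsum_eq]
  split_ifs with hn
  · rw [tsum_eq_single n.toNat fun k hk => if_neg (by omega), if_pos (by omega)]
  · exact (tsum_congr fun k => if_neg (by omega)).trans tsum_zero

variable {m : ℕ} {f : ℝ → ℂ} {T : Matrix (Fin m) (Fin m) ℂ}

theorem toeplitz_form_eq_integral (hf : Continuous f)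
    (hT : ∀ i j : Fin m, ∫ θ in (0 : ℝ)..(2 * π),
      f θ * Complex.exp (-(((i : ℤ) - j : ℤ) * (θ * I))) = T i j) (x : Fin m → ℂ) :
    star x ⬝ᵥ (T *ᵥ x) = ∫ θ in (0 : ℝ)..(2 * π),
      f θ * Complex.normSq (∑ j : Fin m, x j * Complex.exp (j * (θ * I))) := by
  have hexpand : ∀ θ : ℝ, f θ * Complex.normSq (∑ j : Fin m, x j * Complex.exp (j * (θ * I))) =
      ∑ i : Fin m, ∑ j : Fin m, conj (x i) * x j *
        (f θ * Complex.exp (-(((i : ℤ) - j : ℤ) * (θ * I)))) := by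
    intro θ
    rw [Complex.normSq_eq_conj_mul_self, map_sum, sum_mul_sum, mul_sum]
    refine sum_congr rfl fun i _ => ?_
    rw [mul_sum]
    refine sum_congr rfl fun j _ => ?_
    have hexp : Complex.exp (-(((i : ℤ) - j : ℤ) * (θ * I))) =
        conj (Complex.exp (i * (θ * I))) * Complex.exp (j * (θ * I)) := by
      rw [← Complex.exp_conj, ← Complex.exp_add]
      congr 1
      simp only [map_mul, map_natCast, Complex.conj_ofReal, Complex.conj_I]
      push_cast
      ring
    rw [hexp, map_mul]
    ring
  have hcont : ∀ i j : Fin m, Continuous fun θ : ℝ => conj (x i) * x j *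
      (f θ * Complex.exp (-(((i : ℤ) - j : ℤ) * (θ * I)))) :=
    fun i j => continuous_const.mul (hf.mul (by fun_prop))
  simp_rw [hexpand]
  rw [intervalIntegral.integral_finsetSum fun i _ =>
    (continuous_finsetSum _ fun j _ => hcont i j).intervalIntegrable _ _]
  simp only [dotProduct, mulVec, mul_sum]
  refine sum_congr rfl fun i _ => ?_
  rw [intervalIntegral.integral_finsetSum fun j _ => (hcont i j).intervalIntegrable _ _]
  refine sum_congr rfl fun j _ => ?_
  rw [intervalIntegral.integral_const_mul, hT, Pi.star_apply, Complex.star_def]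
  ring

theorem toeplitz_form_re_nonneg (hf : Continuous f)
    (hT : ∀ i j : Fin m, ∫ θ in (0 : ℝ)..(2 * π),
      f θ * Complex.exp (-(((i : ℤ) - j : ℤ) * (θ * I))) = T i j)
    (hre : ∀ θ ∈ Set.Icc 0 (2 * π), 0 ≤ (f θ).re) (x : Fin m → ℂ) :
    0 ≤ (star x ⬝ᵥ (T *ᵥ x)).re := by
  have hcont : Continuous fun θ : ℝ =>
      f θ * Complex.normSq (∑ j : Fin m, x j * Complex.exp (j * (θ * I))) :=
    hf.mul (Complex.continuous_ofReal.comp (Complex.continuous_normSq.comp (by fun_prop)))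
  rw [toeplitz_form_eq_integral hf hT, ← Complex.reCLM_apply,
    ← Complex.reCLM.intervalIntegral_comp_comm (hcont.intervalIntegrable _ _)]
  refine intervalIntegral.integral_nonneg (by positivity) fun θ hθ => ?_
  rw [Complex.reCLM_apply, Complex.re_mul_ofReal]
  exact mul_nonneg (hre θ hθ) (Complex.normSq_nonneg _)

theorem star_dotProduct_map_ofReal_mulVec {ι : Type*} [Fintype ι] (A : Matrix ι ι ℝ)
    (u v : ι → ℝ) :
    (star fun i => (u i + v i * I : ℂ)) ⬝ᵥ (A.map Complex.ofReal *ᵥ fun i => u i + v i * I) =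
      ((u ⬝ᵥ (A *ᵥ u) + v ⬝ᵥ (A *ᵥ v) : ℝ) : ℂ) +
        ((u ⬝ᵥ (A *ᵥ v) - v ⬝ᵥ (A *ᵥ u) : ℝ) : ℂ) * I := by
  simp only [dotProduct, mulVec, mul_sum, ← sum_add_distrib, ← sum_sub_distrib]
  push_cast
  simp only [sum_mul, ← sum_add_distrib]
  refine sum_congr rfl fun i _ => sum_congr rfl fun j _ => ?_
  simp only [Pi.star_apply, Complex.star_def, map_add, map_mul, Complex.conj_ofReal,
    Complex.conj_I, Matrix.map_apply]
  linear_combination (-(v i : ℂ) * v j * A i j) * Complex.I_sq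

end ToeplitzForm

section SectorialMatrices

variable {ι : Type*} [Fintype ι]

/-- A real matrix whose numerical range lies in the sector `|Im z| ≤ μ Re z`. For the complex
vector `u + iv`, the form `z = (u + iv)* A (u + iv)` has real part `uᵀAu + vᵀAv` and imaginary
part `uᵀAv - vᵀAu`. -/
structure IsSectorial (μ : ℝ) (A : Matrix ι ι ℝ) : Prop where
  form_nonneg : ∀ u, 0 ≤ u ⬝ᵥ (A *ᵥ u)
  abs_sub_le : ∀ u v, |u ⬝ᵥ (A *ᵥ v) - v ⬝ᵥ (A *ᵥ u)| ≤ μ * (u ⬝ᵥ (A *ᵥ u) + v ⬝ᵥ (A *ᵥ v))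

theorem dotProduct_transpose_mulVec_comm (A : Matrix ι ι ℝ) (u v : ι → ℝ) :
    u ⬝ᵥ (Aᵀ *ᵥ v) = v ⬝ᵥ (A *ᵥ u) := by
  rw [mulVec_transpose, dotProduct_comm, ← dotProduct_mulVec]

theorem form_smul_add_smul (A : Matrix ι ι ℝ) (s t : ℝ) (u v : ι → ℝ) :
    (s • u + t • v) ⬝ᵥ (A *ᵥ (s • u + t • v)) = s ^ 2 * (u ⬝ᵥ (A *ᵥ u)) +
      s * t * (u ⬝ᵥ (A *ᵥ v) + v ⬝ᵥ (A *ᵥ u)) + t ^ 2 * (v ⬝ᵥ (A *ᵥ v)) := by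
  simp only [mulVec_add, mulVec_smul, dotProduct_add, add_dotProduct, dotProduct_smul,
    smul_dotProduct, smul_eq_mul]
  ring

namespace IsSectorial

variable {μ μ' : ℝ} {A B : Matrix ι ι ℝ}

theorem mono (hA : IsSectorial μ A) (h : μ ≤ μ') : IsSectorial μ' A :=
  ⟨hA.form_nonneg, fun u v => (hA.abs_sub_le u v).trans
    (mul_le_mul_of_nonneg_right h (add_nonneg (hA.form_nonneg u) (hA.form_nonneg v)))⟩

theorem of_posSemidef (hA : A.PosSemidef) : IsSectorial 0 A := by
  refine ⟨fun u => by simpa using hA.dotProduct_mulVec_nonneg u, fun u v => ?_⟩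
  have hsymm : Aᵀ = A := isHermitian_iff_isSymm.1 hA.isHermitian
  rw [← dotProduct_transpose_mulVec_comm, hsymm]
  simp

theorem add (hA : IsSectorial μ A) (hB : IsSectorial μ B) : IsSectorial μ (A + B) := by
  refine ⟨fun u => ?_, fun u v => ?_⟩ <;> simp only [add_mulVec, dotProduct_add]
  · exact add_nonneg (hA.form_nonneg u) (hB.form_nonneg u)
  · have h := (abs_add_le _ _).trans (add_le_add (hA.abs_sub_le u v) (hB.abs_sub_le u v))
    rw [add_sub_add_comm]
    linarith

theorem sum {κ : Type*} {s : Finset κ} {A : κ → Matrix ι ι ℝ}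
    (h : ∀ k ∈ s, IsSectorial μ (A k)) : IsSectorial μ (∑ k ∈ s, A k) :=
  sum_induction A (IsSectorial μ) (fun _ _ => add) ⟨by simp, by simp⟩ h

theorem smul_add_smul_transpose (hA : IsSectorial μ A) {p q : ℝ} (hpq : 0 < p + q) :
    IsSectorial (|p - q| / (p + q) * μ) (p • A + q • Aᵀ) := by
  have hform : ∀ u v, u ⬝ᵥ ((p • A + q • Aᵀ) *ᵥ v) =
      p * (u ⬝ᵥ (A *ᵥ v)) + q * (v ⬝ᵥ (A *ᵥ u)) := by
    intro u v
    rw [add_mulVec, smul_mulVec, smul_mulVec, dotProduct_add, dotProduct_smul, dotProduct_smul,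
      dotProduct_transpose_mulVec_comm, smul_eq_mul, smul_eq_mul]
  refine ⟨fun u => ?_, fun u v => ?_⟩ <;> simp only [hform, ← add_mul]
  · exact mul_nonneg hpq.le (hA.form_nonneg u)
  · calc _ = |p - q| * |u ⬝ᵥ (A *ᵥ v) - v ⬝ᵥ (A *ᵥ u)| := by rw [← abs_mul]; ring_nf
      _ ≤ |p - q| * (μ * (u ⬝ᵥ (A *ᵥ u) + v ⬝ᵥ (A *ᵥ v))) :=
          mul_le_mul_of_nonneg_left (hA.abs_sub_le u v) (abs_nonneg _)
      _ = _ := by field_simp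

theorem sq_sub_le (hA : IsSectorial μ A) (u v : ι → ℝ) :
    (u ⬝ᵥ (A *ᵥ v) - v ⬝ᵥ (A *ᵥ u)) ^ 2 ≤
      4 * μ ^ 2 * ((u ⬝ᵥ (A *ᵥ u)) * (v ⬝ᵥ (A *ᵥ v))) := by
  have hquad : ∀ s : ℝ, 0 ≤ μ * (u ⬝ᵥ (A *ᵥ u)) * (s * s) +
      (u ⬝ᵥ (A *ᵥ v) - v ⬝ᵥ (A *ᵥ u)) * s + μ * (v ⬝ᵥ (A *ᵥ v)) := by
    intro s
    have h := (abs_le.1 (hA.abs_sub_le (s • u) v)).1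
    simp only [mulVec_smul, dotProduct_smul, smul_dotProduct, smul_eq_mul] at h
    linarith
  have h := discrim_le_zero hquad
  rw [discrim] at h
  linarith

theorem sq_add_le (hA : IsSectorial μ A) (u v : ι → ℝ) :
    (u ⬝ᵥ (A *ᵥ v) + v ⬝ᵥ (A *ᵥ u)) ^ 2 ≤ 4 * ((u ⬝ᵥ (A *ᵥ u)) * (v ⬝ᵥ (A *ᵥ v))) := by
  have hquad : ∀ s : ℝ, 0 ≤ u ⬝ᵥ (A *ᵥ u) * (s * s) +
      (u ⬝ᵥ (A *ᵥ v) + v ⬝ᵥ (A *ᵥ u)) * s + v ⬝ᵥ (A *ᵥ v) := by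
    intro s
    have h := hA.form_nonneg (s • u + (1 : ℝ) • v)
    rw [form_smul_add_smul] at h
    linarith
  have h := discrim_le_zero hquad
  rw [discrim] at h
  linarith

theorem sq_form_le (hA : IsSectorial μ A) (y x : ι → ℝ) :
    (y ⬝ᵥ (A *ᵥ x)) ^ 2 ≤ (1 + μ ^ 2) * ((y ⬝ᵥ (A *ᵥ y)) * (x ⬝ᵥ (A *ᵥ x))) := by
  have hadd := hA.sq_add_le y x
  have hsub := hA.sq_sub_le y x
  -- On the component of `y` orthogonal to `x`, the sector bound involves only the Gram determinant.
  have hproj := hA.sq_sub_le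
    ((x ⬝ᵥ (A *ᵥ x)) • y + (-((y ⬝ᵥ (A *ᵥ x) + x ⬝ᵥ (A *ᵥ y)) / 2)) • x) x
  rw [form_smul_add_smul] at hproj
  simp only [mulVec_add, mulVec_smul, dotProduct_add, add_dotProduct, dotProduct_smul,
    smul_dotProduct, smul_eq_mul] at hproj
  have hx := hA.form_nonneg x
  generalize y ⬝ᵥ (A *ᵥ x) = a at *
  generalize x ⬝ᵥ (A *ᵥ y) = b at *
  generalize x ⬝ᵥ (A *ᵥ x) = h at *
  generalize y ⬝ᵥ (A *ᵥ y) = k at *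
  rcases hx.eq_or_lt with rfl | hx
  · nlinarith
  have hskew : ((a - b) / 2) ^ 2 ≤ μ ^ 2 * (k * h - ((a + b) / 2) ^ 2) := by
    refine le_of_mul_le_mul_left ?_ (pow_pos hx 2)
    linarith
  have hgap : 0 ≤ k * h - ((a + b) / 2) ^ 2 := by linarith
  have hcross : 2 * (((a + b) / 2) * ((a - b) / 2)) ≤
      μ ^ 2 * ((a + b) / 2) ^ 2 + (k * h - ((a + b) / 2) ^ 2) := by
    refine le_of_abs_le (abs_le_of_sq_le_sq ?_ (by positivity))
    nlinarith [mul_le_mul_of_nonneg_left hskew (sq_nonneg ((a + b) / 2)),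
      sq_nonneg (μ ^ 2 * ((a + b) / 2) ^ 2 - (k * h - ((a + b) / 2) ^ 2))]
  linarith

end IsSectorial

end SectorialMatrices

section EigenvalueLocalization

variable {ι : Type*} [Fintype ι] [DecidableEq ι] {A P Y : Matrix ι ι ℝ} {μ c l : ℝ} {x : ι → ℝ}

theorem mulVec_eq_smul_of_involution (hYY : Y * Y = 1) (hYP : Y * P = P * Y)
    (hl : (Y * A) *ᵥ x = l • (P *ᵥ x)) : A *ᵥ x = l • (P *ᵥ (Y *ᵥ x)) := by
  rw [mulVec_mulVec, ← hYP, ← mulVec_mulVec, ← mulVec_smul, ← hl, mulVec_mulVec, ← mul_assoc, hYY,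
    one_mul]

theorem form_involution (hY : Y.IsSymm) (hYY : Y * Y = 1) (hYP : Y * P = P * Y) (x : ι → ℝ) :
    (Y *ᵥ x) ⬝ᵥ (P *ᵥ (Y *ᵥ x)) = x ⬝ᵥ (P *ᵥ x) := by
  rw [mulVec_mulVec, ← hYP, ← mulVec_mulVec, ← dotProduct_transpose_mulVec_comm, hY.eq,
    mulVec_mulVec, hYY, one_mulVec, dotProduct_comm]

theorem lt_abs_eigenvalue (hP : P.PosDef) (hY : Y.IsSymm) (hYY : Y * Y = 1) (hYP : Y * P = P * Y)
    (hx : c * (x ⬝ᵥ (P *ᵥ x)) < x ⬝ᵥ (A *ᵥ x)) (hl : (Y * A) *ᵥ x = l • (P *ᵥ x)) :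
    c < |l| := by
  have hsect := IsSectorial.of_posSemidef hP.posSemidef
  have hcs : |x ⬝ᵥ (P *ᵥ (Y *ᵥ x))| ≤ x ⬝ᵥ (P *ᵥ x) := by
    refine abs_le_of_sq_le_sq ?_ (hsect.form_nonneg x)
    have h := hsect.sq_form_le x (Y *ᵥ x)
    rw [form_involution hY hYY hYP] at h
    linarith
  refine lt_of_mul_lt_mul_right ?_ (hsect.form_nonneg x)
  calc c * (x ⬝ᵥ (P *ᵥ x)) < l * (x ⬝ᵥ (P *ᵥ (Y *ᵥ x))) := by
        rwa [mulVec_eq_smul_of_involution hYY hYP hl, dotProduct_smul, smul_eq_mul] at hx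
    _ ≤ |l| * |x ⬝ᵥ (P *ᵥ (Y *ᵥ x))| := (le_abs_self _).trans_eq (abs_mul _ _)
    _ ≤ |l| * (x ⬝ᵥ (P *ᵥ x)) := mul_le_mul_of_nonneg_left hcs (abs_nonneg l)

theorem abs_eigenvalue_lt (hA : IsSectorial μ A) (hP : P.PosDef) (hY : Y.IsSymm)
    (hYY : Y * Y = 1) (hYP : Y * P = P * Y)
    (hup : ∀ z : ι → ℝ, z ≠ 0 → z ⬝ᵥ (A *ᵥ z) < c * (z ⬝ᵥ (P *ᵥ z))) (hx : x ≠ 0)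
    (hl : (Y * A) *ᵥ x = l • (P *ᵥ x)) : |l| < c * √(1 + μ ^ 2) := by
  have hpos : 0 < x ⬝ᵥ (P *ᵥ x) := by simpa using hP.dotProduct_mulVec_pos hx
  have hYx : Y *ᵥ x ≠ 0 := by
    intro h
    have := congrArg (Y *ᵥ ·) h
    simp [hYY, hx] at this
  have hxA := hup x hx
  have hyA := hup _ hYx
  rw [form_involution hY hYY hYP] at hyA
  have hsq := hA.sq_form_le (Y *ᵥ x) x
  rw [mulVec_eq_smul_of_involution hYY hYP hl, dotProduct_smul, smul_eq_mul,
    form_involution hY hYY hYP, ← mulVec_eq_smul_of_involution hYY hYP hl] at hsq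
  have hx0 := hA.form_nonneg x
  have hprod := mul_lt_mul'' hyA hxA (hA.form_nonneg _) hx0
  refine lt_of_mul_lt_mul_right (a := x ⬝ᵥ (P *ᵥ x)) ?_ hpos.le
  rw [← abs_of_pos hpos, ← abs_mul, abs_of_pos hpos]
  refine abs_lt_of_sq_lt_sq (hsq.trans_lt ?_) (by nlinarith [Real.sqrt_nonneg (1 + μ ^ 2)])
  calc _ < (1 + μ ^ 2) * _ := mul_lt_mul_of_pos_left hprod (by positivity)
    _ = _ := by rw [mul_pow, mul_pow, Real.sq_sqrt (by positivity)]; ring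

end EigenvalueLocalization

section GrunwaldSymbol

open scoped Real
open Complex (I)

variable {α : ℝ}

theorem one_sub_mul_sin_le {β φ : ℝ} (h₁ : 1 / 2 ≤ β) (h₂ : β ≤ 1) (h₃ : 0 ≤ φ)
    (h₄ : φ ≤ 2 * π) : (1 - β) * Real.sin (β * φ) ≤ β * Real.sin ((1 - β) * φ) := by
  rcases le_total π (β * φ) with hπ | hπ
  · have hneg : Real.sin (β * φ) ≤ 0 := by
      rw [← neg_nonneg, ← Real.sin_sub_pi]
      exact Real.sin_nonneg_of_nonneg_of_le_pi (by linarith) (by nlinarith [Real.pi_pos])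
    have hpos : 0 ≤ Real.sin ((1 - β) * φ) :=
      Real.sin_nonneg_of_nonneg_of_le_pi (mul_nonneg (by linarith) h₃) (by linarith)
    nlinarith [mul_nonneg (sub_nonneg.2 h₂) (neg_nonneg.2 hneg)]
  · -- `(1 - β) φ` lies between `0` and `β φ`, where the sine is concave.
    have hβ : 0 < β := by linarith
    have hconc := strictConcaveOn_sin_Icc.concaveOn.2
      (show β * φ ∈ Set.Icc 0 π from ⟨by positivity, hπ⟩)
      (show (0 : ℝ) ∈ Set.Icc 0 π from ⟨le_rfl, Real.pi_pos.le⟩)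
      (show 0 ≤ (1 - β) / β from div_nonneg (by linarith) hβ.le)
      (show 0 ≤ 1 - (1 - β) / β by rw [sub_nonneg, div_le_one hβ]; linarith) (by ring)
    simp only [smul_eq_mul, Real.sin_zero, mul_zero, add_zero] at hconc
    rw [show (1 - β) / β * (β * φ) = (1 - β) * φ by field_simp, div_mul_eq_mul_div,
      div_le_iff₀ hβ] at hconc
    linarith

theorem one_sub_exp_mul_I (θ : ℝ) :
    1 - Complex.exp (θ * I) =
      (2 * Real.sin (θ / 2) : ℝ) * Complex.exp (((θ - π) / 2 : ℝ) * I) := by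
  have hsq : Complex.exp (θ * I) = Complex.exp (θ / 2 * I) * Complex.exp (θ / 2 * I) := by
    rw [← Complex.exp_add]
    ring_nf
  have hrot : Complex.exp (((θ - π) / 2 : ℝ) * I) = Complex.exp (θ / 2 * I) * (-I) := by
    rw [← Complex.exp_neg_pi_div_two_mul_I, ← Complex.exp_add]
    push_cast
    ring_nf
  have hinv : Complex.exp (-(θ / 2) * I) * Complex.exp (θ / 2 * I) = 1 := by
    rw [← Complex.exp_add]
    simp
  rw [hsq, hrot]
  push_cast
  rw [Complex.sin]
  linear_combination -hinv +
    (Complex.exp (-(θ / 2) * I) * Complex.exp (θ / 2 * I) - Complex.exp (θ / 2 * I) ^ 2) *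
      Complex.I_sq

theorem one_sub_exp_mul_I_cpow (α : ℝ) {θ : ℝ} (h₁ : 0 < θ) (h₂ : θ < 2 * π) :
    (1 - Complex.exp (θ * I)) ^ (α : ℂ) =
      ((2 * Real.sin (θ / 2)) ^ α : ℝ) * Complex.exp ((α / 2 * (θ - π) : ℝ) * I) := by
  have hr : 0 < 2 * Real.sin (θ / 2) :=
    mul_pos two_pos (Real.sin_pos_of_pos_of_lt_pi (by linarith) (by linarith))
  rw [one_sub_exp_mul_I, Complex.cpow_def_of_ne_zero
      (mul_ne_zero (by exact_mod_cast hr.ne') (Complex.exp_ne_zero _)),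
    Complex.log_ofReal_mul hr (Complex.exp_ne_zero _), Complex.log_exp
      (by rw [Complex.im_ofReal_mul, Complex.I_im]; linarith)
      (by rw [Complex.im_ofReal_mul, Complex.I_im]; linarith [Real.pi_pos]),
    Real.rpow_def_of_pos hr, add_mul, Complex.exp_add]
  push_cast
  congr 2
  ring

/-- The generating function `∑ w_k e^{ikθ}` of the weighted Grünwald coefficients on the unit
circle, in closed form. -/
noncomputable def weightedSymbol (α θ : ℝ) : ℂ :=
  (α / 2 + (2 - α) / 2 * Complex.exp (θ * I)) * (1 - Complex.exp (θ * I)) ^ (α : ℂ)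

theorem continuous_weightedSymbol (hα : 0 < α) : Continuous (weightedSymbol α) := by
  have h := (continuousOn_one_sub_cpow hα).comp_continuous
    (f := fun θ : ℝ => Complex.exp (θ * I)) (by fun_prop) fun θ => by
      simp [Complex.norm_exp_ofReal_mul_I]
  exact Continuous.mul (by fun_prop) h

theorem hasSum_weightedSymbol (h₁ : 1 ≤ α) (h₂ : α ≤ 2) (θ : ℝ) :
    HasSum (fun k => (weightedCoeff α k : ℂ) * Complex.exp (θ * I) ^ k) (weightedSymbol α θ) :=
  hasSum_weightedCoeff h₁ h₂ (Complex.norm_exp_ofReal_mul_I θ).le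

theorem rotated_weightedSymbol {θ : ℝ} (hθ : 0 < θ) (hθ' : θ < 2 * π) :
    I * Complex.exp ((α / 2 * π : ℝ) * I) * (weightedSymbol α θ * Complex.exp (-(θ * I))) =
      ((2 * Real.sin (θ / 2)) ^ α : ℝ) *
        (I * ((α / 2 : ℝ) * Complex.exp ((-((1 - α / 2) * θ) : ℝ) * I) +
          (1 - α / 2 : ℝ) * Complex.exp ((α / 2 * θ : ℝ) * I))) := by
  have hfst : Complex.exp ((-((1 - α / 2) * θ) : ℝ) * I) = Complex.exp ((α / 2 * π : ℝ) * I) *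
      Complex.exp ((α / 2 * (θ - π) : ℝ) * I) * Complex.exp (-(θ * I)) := by
    rw [← Complex.exp_add, ← Complex.exp_add]
    push_cast
    ring_nf
  have hsnd : Complex.exp ((α / 2 * θ : ℝ) * I) =
      Complex.exp ((-((1 - α / 2) * θ) : ℝ) * I) * Complex.exp (θ * I) := by
    rw [← Complex.exp_add]
    push_cast
    ring_nf
  rw [weightedSymbol, one_sub_exp_mul_I_cpow α hθ hθ', hsnd, hfst]
  push_cast
  ring

theorem rotated_weightedSymbol_re_nonneg (h₁ : 1 ≤ α) (h₂ : α ≤ 2) {θ : ℝ}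
    (hθ : θ ∈ Set.Icc 0 (2 * π)) :
    0 ≤ (I * Complex.exp ((α / 2 * π : ℝ) * I) *
      (weightedSymbol α θ * Complex.exp (-(θ * I)))).re := by
  have hα : (α : ℂ) ≠ 0 := by exact_mod_cast (by linarith : α ≠ 0)
  rcases hθ.1.eq_or_lt with rfl | hpos
  · simp [weightedSymbol, hα]
  rcases hθ.2.eq_or_lt with rfl | hlt
  · simp [weightedSymbol, hα]
  have hsin : 0 ≤ Real.sin (θ / 2) :=
    Real.sin_nonneg_of_nonneg_of_le_pi (by linarith) (by linarith)
  rw [rotated_weightedSymbol hpos hlt, Complex.re_ofReal_mul]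
  refine mul_nonneg (by positivity) ?_
  rw [Complex.I_mul_re, Complex.add_im, Complex.im_ofReal_mul, Complex.im_ofReal_mul,
    Complex.exp_ofReal_mul_I_im, Complex.exp_ofReal_mul_I_im, Real.sin_neg]
  have h := one_sub_mul_sin_le (β := α / 2) (by linarith) (by linarith) hθ.1 hθ.2
  linarith

variable {m : ℕ}

theorem integral_weightedSymbol_mul_exp (h₁ : 1 ≤ α) (h₂ : α ≤ 2) (i j : Fin m) :
    ∫ θ in (0 : ℝ)..(2 * π), weightedSymbol α θ * Complex.exp (-(θ * I)) *
      Complex.exp (-(((i : ℤ) - j : ℤ) * (θ * I))) = -(2 * π * grunwaldMatrix α m i j) := by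
  have hexp : ∀ θ : ℝ, weightedSymbol α θ * Complex.exp (-(θ * I)) *
      Complex.exp (-(((i : ℤ) - j : ℤ) * (θ * I))) =
      weightedSymbol α θ * Complex.exp (-(((i : ℤ) + 1 - j : ℤ) * (θ * I))) := by
    intro θ
    rw [mul_assoc, ← Complex.exp_add]
    congr 2
    push_cast
    ring
  simp only [hexp]
  rw [integral_mul_exp_neg_of_hasSum (summable_norm_weightedCoeff h₁ h₂)
    (hasSum_weightedSymbol h₁ h₂), show ((i : ℤ) + 1 - j).toNat = i + 1 - j by omega]
  simp only [grunwaldMatrix, of_apply]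
  split_ifs <;> first | omega | (push_cast; ring)

theorem rotated_grunwaldMatrix_form_nonneg (h₁ : 1 ≤ α) (h₂ : α ≤ 2) (u v : Fin m → ℝ) :
    0 ≤ Real.sin (α / 2 * π) *
        (u ⬝ᵥ (grunwaldMatrix α m *ᵥ u) + v ⬝ᵥ (grunwaldMatrix α m *ᵥ v)) +
      Real.cos (α / 2 * π) *
        (u ⬝ᵥ (grunwaldMatrix α m *ᵥ v) - v ⬝ᵥ (grunwaldMatrix α m *ᵥ u)) := by
  set c : ℂ := I * Complex.exp ((α / 2 * π : ℝ) * I) with hc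
  have hcont : Continuous fun θ : ℝ => c * (weightedSymbol α θ * Complex.exp (-(θ * I))) :=
    continuous_const.mul ((continuous_weightedSymbol (by linarith)).mul (by fun_prop))
  have h := toeplitz_form_re_nonneg hcont (T := (-(2 * π) * c) •
      (grunwaldMatrix α m).map Complex.ofReal)
    (fun i j => by
      simp_rw [mul_assoc c]
      rw [intervalIntegral.integral_const_mul, integral_weightedSymbol_mul_exp h₁ h₂,
        Matrix.smul_apply, Matrix.map_apply, smul_eq_mul]
      ring)
    (fun θ hθ => rotated_weightedSymbol_re_nonneg h₁ h₂ hθ) fun i => u i + v i * I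
  rw [smul_mulVec, dotProduct_smul, star_dotProduct_map_ofReal_mulVec] at h
  generalize u ⬝ᵥ (grunwaldMatrix α m *ᵥ u) + v ⬝ᵥ (grunwaldMatrix α m *ᵥ v) = p at *
  generalize u ⬝ᵥ (grunwaldMatrix α m *ᵥ v) - v ⬝ᵥ (grunwaldMatrix α m *ᵥ u) = q at *
  have hre : ((-(2 * π) * c) • ((p : ℂ) + q * I)).re =
      2 * π * (Real.sin (α / 2 * π) * p + Real.cos (α / 2 * π) * q) := by
    rw [hc, Complex.exp_mul_I, ← Complex.ofReal_cos, ← Complex.ofReal_sin]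
    generalize Real.sin (α / 2 * π) = s
    generalize Real.cos (α / 2 * π) = t
    simp only [smul_eq_mul, Complex.mul_re, Complex.mul_im, Complex.add_re, Complex.add_im,
      Complex.neg_re, Complex.neg_im, Complex.ofReal_re, Complex.ofReal_im, Complex.I_re,
      Complex.I_im, Complex.re_ofNat, Complex.im_ofNat]
    ring
  rw [hre] at h
  exact (mul_nonneg_iff_of_pos_left (by positivity)).1 h

theorem tauMatrix_grunwaldMatrix_form_bounds (h₁ : 1 ≤ α) (h₂ : α ≤ 2) (x : Fin m → ℝ) :
    1 / 2 * (x ⬝ᵥ (tauMatrix (symPart (grunwaldMatrix α m)) *ᵥ x)) ≤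
        x ⬝ᵥ (grunwaldMatrix α m *ᵥ x) ∧
      x ⬝ᵥ (grunwaldMatrix α m *ᵥ x) ≤
        3 / 2 * (x ⬝ᵥ (tauMatrix (symPart (grunwaldMatrix α m)) *ᵥ x)) := by
  have hform : x ⬝ᵥ (grunwaldMatrix α m *ᵥ x) =
      x ⬝ᵥ (symmToeplitz (symCoeff α) m *ᵥ x) := by
    rw [← symPart_grunwaldMatrix, symPart, smul_mulVec, add_mulVec, dotProduct_smul,
      dotProduct_add, dotProduct_transpose_mulVec_comm, smul_eq_mul]
    ring
  rw [hform, symPart_grunwaldMatrix]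
  exact tauMatrix_symmToeplitz_form_bounds (symCoeff_succ_nonpos h₁ h₂)
    (symCoeff_succ_monotone h₁ h₂) (symCoeff_zero_add_two_mul_sum_nonneg h₁ h₂) x

theorem grunwaldMatrix_isSectorial (h₁ : 1 < α) (h₂ : α ≤ 2) :
    IsSectorial |Real.tan (α / 2 * π)| (grunwaldMatrix α m) := by
  have hsin : 0 ≤ Real.sin (α / 2 * π) :=
    Real.sin_nonneg_of_nonneg_of_le_pi (by positivity) (by nlinarith [Real.pi_pos])
  have hcos : Real.cos (α / 2 * π) < 0 :=
    Real.cos_neg_of_pi_div_two_lt_of_lt (by nlinarith [Real.pi_pos]) (by nlinarith [Real.pi_pos])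
  refine ⟨fun u => ?_, fun u v => ?_⟩
  · have h := tauMatrix_grunwaldMatrix_form_bounds h₁.le h₂ u
    linarith
  · have huv := rotated_grunwaldMatrix_form_nonneg h₁.le h₂ u v
    have hvu := rotated_grunwaldMatrix_form_nonneg h₁.le h₂ v u
    rw [Real.tan_eq_sin_div_cos, abs_div, abs_of_nonneg hsin, abs_of_neg hcos, div_mul_eq_mul_div,
      le_div_iff₀ (neg_pos.2 hcos), ← abs_of_neg hcos, ← abs_mul, abs_le]
    constructor <;> linarith

end GrunwaldSymbol

section Chebyshev

open Polynomial

variable {a b : ℝ}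

/-- The quadratic polynomial in `X ^ 2` that maps `{x | a ≤ |x| ≤ b}` onto `[-1, 1]`. -/
noncomputable def twoIntervalMap (a b : ℝ) : ℝ[X] :=
  C ((b ^ 2 + a ^ 2) / (b ^ 2 - a ^ 2)) - C (2 / (b ^ 2 - a ^ 2)) * X ^ 2

theorem natDegree_twoIntervalMap_le (a b : ℝ) : (twoIntervalMap a b).natDegree ≤ 2 := by
  rw [twoIntervalMap]
  compute_degree

theorem eval_twoIntervalMap (a b x : ℝ) :
    (twoIntervalMap a b).eval x = (b ^ 2 + a ^ 2 - 2 * x ^ 2) / (b ^ 2 - a ^ 2) := by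
  simp only [twoIntervalMap, eval_sub, eval_C, eval_mul, eval_pow, eval_X]
  ring

theorem abs_eval_twoIntervalMap_le_one (ha : 0 < a) (hab : a < b) {x : ℝ} (h₁ : a ≤ |x|)
    (h₂ : |x| ≤ b) : |(twoIntervalMap a b).eval x| ≤ 1 := by
  have hx₁ : a ^ 2 ≤ x ^ 2 := by rw [← sq_abs x]; gcongr
  have hx₂ : x ^ 2 ≤ b ^ 2 := by rw [← sq_abs x]; gcongr
  have hd : 0 < b ^ 2 - a ^ 2 := by nlinarith
  rw [eval_twoIntervalMap, abs_div, abs_of_pos hd, div_le_one hd, abs_le]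
  constructor <;> linarith

theorem eval_zero_twoIntervalMap (ha : 0 < a) (hab : a < b) :
    (twoIntervalMap a b).eval 0 = Real.cosh (Real.log ((b + a) / (b - a))) := by
  have hba : 0 < b - a := by linarith
  have hba' : 0 < b + a := by linarith
  rw [eval_twoIntervalMap, Real.cosh_log (div_pos hba' hba),
    show b ^ 2 - a ^ 2 = (b - a) * (b + a) by ring]
  field_simp
  ring

theorem pow_div_two_le_eval_chebyshev_cosh_log {ρ : ℝ} (hρ : 0 < ρ) (j : ℕ) :
    ρ ^ j / 2 ≤ (Chebyshev.T ℝ j).eval (Real.cosh (Real.log ρ)) := by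
  rw [Chebyshev.T_real_cosh, Int.cast_natCast, ← Real.log_pow, Real.cosh_log (by positivity)]
  have : 0 < (ρ ^ j)⁻¹ := by positivity
  linarith

theorem exists_polynomial_abs_eval_le (ha : 0 < a) (hab : a < b) (j : ℕ) :
    ∃ p : ℝ[X], p.natDegree ≤ 2 * j ∧ p.eval 0 = 1 ∧
      ∀ x : ℝ, a ≤ |x| → |x| ≤ b → |p.eval x| ≤ 2 * ((b - a) / (b + a)) ^ j := by
  have : 0 < b - a := by linarith
  have : 0 < b + a := by linarith
  set q : ℝ[X] := (Chebyshev.T ℝ j).comp (twoIntervalMap a b) with hq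
  have hq₀ : ((b + a) / (b - a)) ^ j / 2 ≤ q.eval 0 := by
    rw [hq, eval_comp, eval_zero_twoIntervalMap ha hab]
    exact pow_div_two_le_eval_chebyshev_cosh_log (by positivity) j
  have hq_pos : 0 < q.eval 0 := lt_of_lt_of_le (by positivity) hq₀
  refine ⟨C (q.eval 0)⁻¹ * q, ?_, ?_, fun x h₁ h₂ => ?_⟩
  · calc (C (q.eval 0)⁻¹ * q).natDegree ≤ q.natDegree := natDegree_C_mul_le _ _
      _ = j * (twoIntervalMap a b).natDegree := by
        rw [hq, natDegree_comp, Chebyshev.natDegree_T, Int.natAbs_natCast]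
      _ ≤ 2 * j := by
        rw [mul_comm]
        gcongr
        exact natDegree_twoIntervalMap_le a b
  · rw [eval_mul, eval_C, inv_mul_cancel₀ hq_pos.ne']
  · have hqx : |q.eval x| ≤ 1 := by
      rw [hq, eval_comp]
      exact Chebyshev.abs_eval_T_real_le_one j (abs_eval_twoIntervalMap_le_one ha hab h₁ h₂)
    rw [eval_mul, eval_C, abs_mul, abs_of_pos (inv_pos.2 hq_pos)]
    calc (q.eval 0)⁻¹ * |q.eval x| ≤ (((b + a) / (b - a)) ^ j / 2)⁻¹ * 1 := by gcongr
      _ = 2 * ((b - a) / (b + a)) ^ j := by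
        rw [mul_one, inv_div, div_eq_mul_inv, ← inv_pow, inv_div]

end Chebyshev

section Pencil

variable {ι : Type*} [Fintype ι] [DecidableEq ι] {M P : Matrix ι ι ℝ}

open scoped MatrixOrder Matrix.Norms.L2Operator in
theorem exists_unit_eq_transpose_mul_self (hP : P.PosDef) :
    ∃ B : (Matrix ι ι ℝ)ˣ, P = (B : Matrix ι ι ℝ)ᵀ * B := by
  obtain ⟨B, hB⟩ := CStarAlgebra.nonneg_iff_eq_star_mul_self.mp hP.posSemidef.nonneg
  rw [Matrix.star_eq_conjTranspose, Matrix.conjTranspose_eq_transpose_of_trivial] at hB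
  have hdet : IsUnit B.det := by
    have := (Matrix.isUnit_iff_isUnit_det _).1 hP.isUnit
    rw [hB, Matrix.det_mul] at this
    exact isUnit_of_mul_isUnit_right this
  exact ⟨B.nonsingInvUnit hdet, hB⟩

theorem exists_simultaneous_diagonalization (hM : M.IsSymm) (hP : P.PosDef) :
    ∃ (V : (Matrix ι ι ℝ)ˣ) (l : ι → ℝ), P = (V : Matrix ι ι ℝ)ᵀ * V ∧
      P⁻¹ * M = (↑V⁻¹ : Matrix ι ι ℝ) * diagonal l * (V : Matrix ι ι ℝ) := by
  obtain ⟨B, rfl⟩ := exists_unit_eq_transpose_mul_self hP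
  have hN : ((B : Matrix ι ι ℝ)⁻¹ᵀ * M * (B : Matrix ι ι ℝ)⁻¹).IsHermitian := by
    rw [Matrix.isHermitian_iff_isSymm, Matrix.IsSymm, Matrix.transpose_mul, Matrix.transpose_mul,
      Matrix.transpose_transpose, hM.eq, Matrix.mul_assoc]
  set U := hN.eigenvectorUnitary
  have hUU : (U : Matrix ι ι ℝ) * (U : Matrix ι ι ℝ)ᵀ = 1 := by
    simpa [Matrix.star_eq_conjTranspose] using Unitary.coe_mul_star_self U
  have hspec : (B : Matrix ι ι ℝ)⁻¹ᵀ * M * (B : Matrix ι ι ℝ)⁻¹ =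
      (U : Matrix ι ι ℝ) * diagonal hN.eigenvalues * (U : Matrix ι ι ℝ)ᵀ := by
    simpa [Unitary.conjStarAlgAut_apply, Matrix.star_eq_conjTranspose, Function.comp_def]
      using hN.spectral_theorem
  have hV : ((Unitary.toUnits U)⁻¹ * B : (Matrix ι ι ℝ)ˣ) = (U : Matrix ι ι ℝ)ᵀ * B := by
    simp [Matrix.star_eq_conjTranspose]
  refine ⟨(Unitary.toUnits U)⁻¹ * B, hN.eigenvalues, ?_, ?_⟩
  · rw [hV, Matrix.transpose_mul, Matrix.transpose_transpose, Matrix.mul_assoc,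
      ← Matrix.mul_assoc (U : Matrix ι ι ℝ), hUU, Matrix.one_mul]
  · calc ((B : Matrix ι ι ℝ)ᵀ * B)⁻¹ * M =
        (B : Matrix ι ι ℝ)⁻¹ * ((B : Matrix ι ι ℝ)⁻¹ᵀ * M * (B : Matrix ι ι ℝ)⁻¹) * B := by
          simp [Matrix.mul_inv_rev, Matrix.transpose_nonsing_inv, Matrix.mul_assoc]
      _ = (↑((Unitary.toUnits U)⁻¹ * B)⁻¹ : Matrix ι ι ℝ) * diagonal hN.eigenvalues *
          (↑((Unitary.toUnits U)⁻¹ * B) : Matrix ι ι ℝ) := by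
        rw [congrArg (_ * · * _) hspec, hV]
        simp [Matrix.mul_assoc]

theorem spectrum_inv_mul_mul (V : (Matrix ι ι ℝ)ˣ) (l : ι → ℝ) :
    spectrum ℝ ((↑V⁻¹ : Matrix ι ι ℝ) * diagonal l * V) = Set.range l := by
  rw [spectrum.units_conjugate', spectrum_diagonal]

theorem spectrum_map_inv_mul_mul (V : (Matrix ι ι ℝ)ˣ) (l : ι → ℝ) :
    spectrum ℂ (((↑V⁻¹ : Matrix ι ι ℝ) * diagonal l * V).map (algebraMap ℝ ℂ)) =
      Set.range fun i => (l i : ℂ) := by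
  let W := Units.map ((algebraMap ℝ ℂ).mapMatrix (m := ι)).toMonoidHom V
  have hW : ((↑V⁻¹ : Matrix ι ι ℝ) * diagonal l * V).map (algebraMap ℝ ℂ) =
      (↑W⁻¹ : Matrix ι ι ℂ) * diagonal (fun i => (l i : ℂ)) * W := by
    rw [Matrix.map_mul, Matrix.map_mul, Matrix.diagonal_map (map_zero _)]
    rfl
  rw [hW, spectrum.units_conjugate', spectrum_diagonal]

theorem spectrum_complex_eq_image_ofReal (hM : M.IsSymm) (hP : P.PosDef) :
    spectrum ℂ ((P⁻¹ * M).map (algebraMap ℝ ℂ)) =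
      Complex.ofReal '' spectrum ℝ (P⁻¹ * M) := by
  obtain ⟨V, l, -, hV⟩ := exists_simultaneous_diagonalization hM hP
  rw [hV, spectrum_map_inv_mul_mul, spectrum_inv_mul_mul, ← Set.range_comp]
  rfl

theorem exists_mulVec_eq_smul_mulVec (hP : P.PosDef) {l : ℝ} (hl : l ∈ spectrum ℝ (P⁻¹ * M)) :
    ∃ x : ι → ℝ, x ≠ 0 ∧ M *ᵥ x = l • (P *ᵥ x) := by
  rw [← Matrix.spectrum_toLin', ← Module.End.hasEigenvalue_iff_mem_spectrum] at hl
  obtain ⟨x, hx⟩ := hl.exists_hasEigenvector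
  refine ⟨x, hx.2, ?_⟩
  have hdet := (Matrix.isUnit_iff_isUnit_det P).1 hP.isUnit
  rw [← Matrix.mulVec_smul, ← hx.apply_eq_smul, Matrix.toLin'_apply, Matrix.mulVec_mulVec,
    ← Matrix.mul_assoc, Matrix.mul_nonsing_inv P hdet, Matrix.one_mul]

end Pencil

section ResidualPolynomials

variable {ι : Type*} [Fintype ι]

theorem energyNorm_transpose_mul_self (V : Matrix ι ι ℝ) (z : ι → ℝ) :
    energyNorm (Vᵀ * V) z = √(∑ i, (V *ᵥ z) i ^ 2) := by
  rw [energyNorm, ← Matrix.mulVec_mulVec, Matrix.dotProduct_mulVec, Matrix.vecMul_transpose]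
  simp only [dotProduct, sq]

variable [DecidableEq ι] {M P : Matrix ι ι ℝ}

open Polynomial

theorem aeval_units_conj {A : Type*} [Ring A] [Algebra ℝ A] (V : Aˣ) (D : A) (p : ℝ[X]) :
    aeval (↑V⁻¹ * D * V) p = ↑V⁻¹ * aeval D p * V := by
  induction p using Polynomial.induction_on' with
  | add p q hp hq => rw [map_add, map_add, hp, hq, mul_add, add_mul]
  | monomial n a =>
    rw [aeval_monomial, aeval_monomial, Units.conj_pow', ← mul_assoc, ← mul_assoc, ← mul_assoc,
      Algebra.commutes]

theorem aeval_diagonal (l : ι → ℝ) (p : ℝ[X]) :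
    aeval (diagonal l) p = diagonal fun i => p.eval (l i) := by
  simpa [aeval_pi_apply] using aeval_algHom_apply (Matrix.diagonalAlgHom ℝ) l p

theorem energyNorm_aeval_mulVec_le (hM : M.IsSymm) (hP : P.PosDef) {p : ℝ[X]} {K : ℝ}
    (hK : 0 ≤ K) (hp : ∀ l ∈ spectrum ℝ (P⁻¹ * M), |p.eval l| ≤ K) (r : ι → ℝ) :
    energyNorm P (aeval (P⁻¹ * M) p *ᵥ r) ≤ K * energyNorm P r := by
  obtain ⟨V, l, hPV, hV⟩ := exists_simultaneous_diagonalization hM hP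
  simp only [hV, spectrum_inv_mul_mul, Set.forall_mem_range] at hp
  have hcoord : ∀ i, (V.1 *ᵥ (aeval (P⁻¹ * M) p *ᵥ r)) i = p.eval (l i) * (V.1 *ᵥ r) i := by
    intro i
    rw [hV, aeval_units_conj, aeval_diagonal, Matrix.mulVec_mulVec, Matrix.mul_assoc,
      V.mul_inv_cancel_left, ← Matrix.mulVec_mulVec, Matrix.mulVec_diagonal]
  rw [hPV, energyNorm_transpose_mul_self, energyNorm_transpose_mul_self, ← hPV,
    Real.sqrt_le_left (by positivity), mul_pow, Real.sq_sqrt (by positivity), Finset.mul_sum]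
  refine Finset.sum_le_sum fun i _ => ?_
  rw [hcoord, mul_pow, ← sq_abs (p.eval (l i))]
  gcongr
  exact hp i

theorem aeval_mulVec_mem_krylov (B : Matrix ι ι ℝ) (r : ι → ℝ) {q : ℝ[X]} {k : ℕ}
    (hq : q.degree < k) : aeval B q *ᵥ r ∈ krylov B r k := by
  rw [aeval_def, eval₂_eq_sum, Polynomial.sum_def, Matrix.sum_mulVec]
  refine Submodule.sum_mem _ fun j hj => ?_
  rw [← Algebra.smul_def, Matrix.smul_mulVec]
  refine Submodule.smul_mem _ _ (Submodule.subset_span ⟨j, ?_, rfl⟩)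
  exact_mod_cast (le_degree_of_mem_supp j hj).trans_lt hq

theorem precResidual_sub_mulVec (c u w : ι → ℝ) :
    precResidual M P c (u - w) = precResidual M P c u + (P⁻¹ * M) *ᵥ w := by
  rw [precResidual, precResidual, Matrix.mulVec_sub]
  abel

theorem energyNorm_minres_le_aeval {c u₀ u : ι → ℝ} {k : ℕ} (hu : IsMinresIterate M P c u₀ k u)
    {p : ℝ[X]} (hp : p.natDegree ≤ k) (hp₀ : p.eval 0 = 1) :
    energyNorm P (precResidual M P c u) ≤
      energyNorm P (aeval (P⁻¹ * M) p *ᵥ precResidual M P c u₀) := by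
  set r := precResidual M P c u₀
  have hp_ne : p ≠ 0 := by
    rintro rfl
    simp at hp₀
  have hdeg : p.divX.degree < k :=
    (degree_divX_lt hp_ne).trans_le (natDegree_le_iff_degree_le.1 hp)
  have hres : precResidual M P c (u₀ - aeval (P⁻¹ * M) p.divX *ᵥ r) =
      aeval (P⁻¹ * M) p *ᵥ r := by
    conv_rhs => rw [← X_mul_divX_add p, coeff_zero_eq_eval_zero, hp₀]
    rw [precResidual_sub_mulVec, map_add, map_mul, aeval_X, aeval_C, map_one, Matrix.add_mulVec,
      Matrix.one_mulVec, Matrix.mulVec_mulVec, add_comm]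
  rw [← hres]
  refine hu.2 _ ?_
  rw [sub_sub_cancel_left]
  exact Submodule.neg_mem _ (aeval_mulVec_mem_krylov _ r hdeg)

theorem energyNorm_minres_le (hM : M.IsSymm) (hP : P.PosDef) {c u₀ u : ι → ℝ} {k : ℕ}
    (hu : IsMinresIterate M P c u₀ k u) {a b : ℝ} (ha : 0 < a) (hab : a < b)
    (h : ∀ l ∈ spectrum ℝ (P⁻¹ * M), a ≤ |l| ∧ |l| ≤ b) :
    energyNorm P (precResidual M P c u) ≤
      2 * ((b - a) / (b + a)) ^ (k / 2) * energyNorm P (precResidual M P c u₀) := by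
  obtain ⟨p, hp, hp₀, hpb⟩ := exists_polynomial_abs_eval_le ha hab (k / 2)
  have : 0 < b - a := by linarith
  have : 0 < b + a := by linarith
  exact (energyNorm_minres_le_aeval hu (hp.trans (Nat.mul_div_le k 2)) hp₀).trans
    (energyNorm_aeval_mulVec_le hM hP (by positivity)
      (fun l hl => hpb l (h l hl).1 (h l hl).2) _)

end ResidualPolynomials

section GridReversal

variable {d : ℕ} {n : Fin d → ℕ}

/-- The permutation of the grid points that reverses every coordinate. -/
def gridRev (n : Fin d → ℕ) : Equiv.Perm (Grid n) :=
  Equiv.piCongrRight fun _ => Fin.revPerm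

theorem gridRev_apply (x : Grid n) (i : Fin d) : gridRev n x i = (x i).rev := rfl

theorem gridRev_involutive : Function.Involutive (gridRev n) := fun x => by
  ext i
  rw [gridRev_apply, gridRev_apply, Fin.rev_rev]

theorem antiIdentity_apply {m : ℕ} (i j : Fin m) :
    antiIdentity m i j = if i.rev = j then 1 else 0 := by
  simp only [antiIdentity, Matrix.of_apply, Fin.ext_iff, Fin.val_rev]
  grind

theorem multiAntiIdentity_eq_permMatrix :
    multiAntiIdentity n = (gridRev n).permMatrix ℝ := by
  ext x y
  simp only [multiAntiIdentity, kron, Matrix.of_apply, antiIdentity_apply, prod_ite_zero,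
    prod_const_one, PEquiv.toMatrix_apply, Equiv.toPEquiv_apply, Option.mem_some_iff, funext_iff,
    gridRev_apply, mem_univ, true_imp_iff]

theorem multiAntiIdentity_mul_apply (M : Matrix (Grid n) (Grid n) ℝ) (x y : Grid n) :
    (multiAntiIdentity n * M) x y = M (gridRev n x) y := by
  rw [multiAntiIdentity_eq_permMatrix, PEquiv.toMatrix_toPEquiv_mul, submatrix_apply, id]

theorem mul_multiAntiIdentity_apply (M : Matrix (Grid n) (Grid n) ℝ) (x y : Grid n) :
    (M * multiAntiIdentity n) x y = M x (gridRev n y) := by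
  rw [multiAntiIdentity_eq_permMatrix, PEquiv.mul_toMatrix_toPEquiv, submatrix_apply, id,
    gridRev_involutive.symm_eq_self_of_involutive]

theorem multiAntiIdentity_isSymm : (multiAntiIdentity n).IsSymm := by
  rw [Matrix.IsSymm, multiAntiIdentity_eq_permMatrix, transpose_permMatrix, Equiv.Perm.inv_def,
    gridRev_involutive.symm_eq_self_of_involutive]

theorem multiAntiIdentity_mul_self : multiAntiIdentity n * multiAntiIdentity n = 1 := by
  rw [multiAntiIdentity_eq_permMatrix, ← permMatrix_mul,
    Equiv.ext (f := gridRev n * gridRev n) (g := 1) gridRev_involutive, permMatrix_one]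

theorem axisMatrix_gridRev (i : Fin d) {L L' : Matrix (Fin (n i)) (Fin (n i)) ℝ}
    (h : ∀ k l, L k.rev l.rev = L' k l) (x y : Grid n) :
    axisMatrix n i L (gridRev n x) (gridRev n y) = axisMatrix n i L' x y := by
  simp only [axisMatrix, kron, Matrix.of_apply]
  refine prod_congr rfl fun j _ => ?_
  rcases eq_or_ne j i with rfl | hj
  · simp only [Function.update_self, gridRev_apply, h]
  · simp only [Function.update_of_ne hj, gridRev_apply, Matrix.one_apply, Fin.rev_inj]

theorem axisMatrix_transpose (i : Fin d) (L : Matrix (Fin (n i)) (Fin (n i)) ℝ) :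
    (axisMatrix n i L)ᵀ = axisMatrix n i Lᵀ := by
  ext x y
  simp only [axisMatrix, kron, Matrix.transpose_apply, Matrix.of_apply]
  refine prod_congr rfl fun j _ => ?_
  rcases eq_or_ne j i with rfl | hj
  · simp only [Function.update_self, Matrix.transpose_apply]
  · simp only [Function.update_of_ne hj, Matrix.one_apply, eq_comm]

end GridReversal

section GridLines

variable {d : ℕ} {n : Fin d → ℕ} {i : Fin d}

/-- The restriction of a grid function to the grid line in direction `i` whose remaining
coordinates are `r`. -/
def gridLine (i : Fin d) (r : (j : {j // j ≠ i}) → Fin (n j)) (u : Grid n → ℝ) : Fin (n i) → ℝ :=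
  fun k => u ((Equiv.piSplitAt i fun j => Fin (n j)).symm (k, r))

theorem axisMatrix_piSplitAt_symm (L : Matrix (Fin (n i)) (Fin (n i)) ℝ)
    (p q : Fin (n i) × ((j : {j // j ≠ i}) → Fin (n j))) :
    axisMatrix n i L ((Equiv.piSplitAt i _).symm p) ((Equiv.piSplitAt i _).symm q) =
      if p.2 = q.2 then L p.1 q.1 else 0 := by
  have hon (r) : (Equiv.piSplitAt i fun j => Fin (n j)).symm r i = r.1 := by
    rw [Equiv.piSplitAt_symm_apply, dif_pos rfl]
  have hoff (r) (j : {j // j ≠ i}) : (Equiv.piSplitAt i fun j => Fin (n j)).symm r j = r.2 j := by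
    rw [Equiv.piSplitAt_symm_apply, dif_neg j.2]
  have hone (j : {j // j ≠ i}) :
      Function.update (fun j => (1 : Matrix (Fin (n j)) (Fin (n j)) ℝ)) i L j = 1 :=
    Function.update_of_ne j.2 _ _
  rw [axisMatrix, kron, Matrix.of_apply, Fintype.prod_eq_mul_prod_subtype_ne _ i]
  simp only [Function.update_self, hone, hon, hoff, Matrix.one_apply, prod_ite_zero,
    prod_const_one, mem_univ, forall_const, funext_iff, mul_ite, mul_one, mul_zero]

theorem axisMatrix_form (L : Matrix (Fin (n i)) (Fin (n i)) ℝ) (u v : Grid n → ℝ) :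
    u ⬝ᵥ (axisMatrix n i L *ᵥ v) = ∑ r, gridLine i r u ⬝ᵥ (L *ᵥ gridLine i r v) := by
  simp only [dotProduct, mulVec]
  rw [← (Equiv.piSplitAt i fun j => Fin (n j)).symm.sum_comp, Fintype.sum_prod_type_right]
  refine sum_congr rfl fun r _ => sum_congr rfl fun k _ => ?_
  rw [← (Equiv.piSplitAt i fun j => Fin (n j)).symm.sum_comp, Fintype.sum_prod_type]
  simp [axisMatrix_piSplitAt_symm, gridLine]

theorem axisMatrix_form_le {L L' : Matrix (Fin (n i)) (Fin (n i)) ℝ} {c : ℝ}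
    (h : ∀ x, x ⬝ᵥ (L *ᵥ x) ≤ c * (x ⬝ᵥ (L' *ᵥ x))) (u : Grid n → ℝ) :
    u ⬝ᵥ (axisMatrix n i L *ᵥ u) ≤ c * (u ⬝ᵥ (axisMatrix n i L' *ᵥ u)) := by
  rw [axisMatrix_form, axisMatrix_form, mul_sum]
  exact sum_le_sum fun r _ => h _

theorem IsSectorial.axisMatrix {L : Matrix (Fin (n i)) (Fin (n i)) ℝ} {μ : ℝ}
    (hL : IsSectorial μ L) : IsSectorial μ (axisMatrix n i L) := by
  refine ⟨fun u => ?_, fun u v => ?_⟩ <;> simp only [axisMatrix_form]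
  · exact sum_nonneg fun r _ => hL.form_nonneg _
  · rw [← sum_sub_distrib, ← sum_add_distrib, mul_sum]
    exact (abs_sum_le_sum_abs _ _).trans (sum_le_sum fun r _ => hL.abs_sub_le _ _)

end GridLines

section System

variable {d : ℕ} {α dp dm a b : Fin d → ℝ} {n : Fin d → ℕ} {ν μ : ℝ}

theorem axisMatrix_grunwaldMatrix_gridRev (α : ℝ) (i : Fin d) (x y : Grid n) :
    axisMatrix n i (grunwaldMatrix α (n i)) (gridRev n x) (gridRev n y) =
      axisMatrix n i (grunwaldMatrix α (n i)) y x := by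
  rw [axisMatrix_gridRev i (L' := (grunwaldMatrix α (n i))ᵀ) (grunwaldMatrix_rev α),
    ← axisMatrix_transpose, transpose_apply]

theorem systemMatrix_gridRev (x y : Grid n) :
    systemMatrix ν α dp dm a b n (gridRev n x) (gridRev n y) =
      systemMatrix ν α dp dm a b n y x := by
  simp only [systemMatrix, Matrix.add_apply, Matrix.smul_apply, Matrix.sum_apply, transpose_apply,
    Matrix.one_apply, EmbeddingLike.apply_eq_iff_eq, axisMatrix_grunwaldMatrix_gridRev,
    eq_comm (a := x)]

theorem multiAntiIdentity_mul_systemMatrix_isSymm :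
    (multiAntiIdentity n * systemMatrix ν α dp dm a b n).IsSymm := by
  ext x y
  rw [transpose_apply, multiAntiIdentity_mul_apply, multiAntiIdentity_mul_apply,
    ← systemMatrix_gridRev, gridRev_involutive]

theorem tauPreconditioner_gridRev (x y : Grid n) :
    tauPreconditioner ν α dp dm a b n (gridRev n x) (gridRev n y) =
      tauPreconditioner ν α dp dm a b n x y := by
  simp only [tauPreconditioner, Matrix.add_apply, Matrix.smul_apply, Matrix.sum_apply,
    Matrix.one_apply, EmbeddingLike.apply_eq_iff_eq, symPart_grunwaldMatrix,
    axisMatrix_gridRev _ (tauMatrix_symmToeplitz_rev _)]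

theorem multiAntiIdentity_mul_tauPreconditioner :
    multiAntiIdentity n * tauPreconditioner ν α dp dm a b n =
      tauPreconditioner ν α dp dm a b n * multiAntiIdentity n := by
  ext x y
  rw [multiAntiIdentity_mul_apply, mul_multiAntiIdentity_apply, ← tauPreconditioner_gridRev x,
    gridRev_involutive]

theorem tauPreconditioner_isSymm : (tauPreconditioner ν α dp dm a b n).IsSymm := by
  simp only [Matrix.IsSymm, tauPreconditioner, transpose_add, transpose_smul, transpose_one,
    transpose_sum, axisMatrix_transpose, (tauMatrix_isSymm (symPart_isSymm _)).eq]

theorem systemMatrix_form_self (u : Grid n → ℝ) :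
    u ⬝ᵥ (systemMatrix ν α dp dm a b n *ᵥ u) = ν * (u ⬝ᵥ u) +
      ∑ i, (scaledCoeff (dp i) (α i) (a i) (b i) (n i) +
          scaledCoeff (dm i) (α i) (a i) (b i) (n i)) *
        (u ⬝ᵥ (axisMatrix n i (grunwaldMatrix (α i) (n i)) *ᵥ u)) := by
  simp only [systemMatrix, add_mulVec, smul_mulVec, one_mulVec, sum_mulVec, dotProduct_add,
    dotProduct_smul, dotProduct_sum, smul_eq_mul, dotProduct_transpose_mulVec_comm, add_mul]

theorem tauPreconditioner_form (u v : Grid n → ℝ) :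
    u ⬝ᵥ (tauPreconditioner ν α dp dm a b n *ᵥ v) = ν * (u ⬝ᵥ v) +
      ∑ i, (scaledCoeff (dp i) (α i) (a i) (b i) (n i) +
          scaledCoeff (dm i) (α i) (a i) (b i) (n i)) *
        (u ⬝ᵥ (axisMatrix n i (tauMatrix (symPart (grunwaldMatrix (α i) (n i)))) *ᵥ v)) := by
  simp only [tauPreconditioner, add_mulVec, smul_mulVec, one_mulVec, sum_mulVec, dotProduct_add,
    dotProduct_smul, dotProduct_sum, smul_eq_mul]

theorem scaledCoeff_eq_mul (D α a b : ℝ) (m : ℕ) :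
    scaledCoeff D α a b m = D * scaledCoeff 1 α a b m :=
  div_eq_mul_one_div _ _

theorem scaledCoeff_one_pos {a b : ℝ} (hab : a < b) (α : ℝ) (m : ℕ) :
    0 < scaledCoeff 1 α a b m := by
  have : 0 < (b - a) / ((m : ℝ) + 1) := div_pos (sub_pos.2 hab) m.cast_add_one_pos
  rw [scaledCoeff]
  positivity

theorem scaledCoeff_add_pos {p q a b : ℝ} (hpq : 0 < p + q) (hab : a < b) (α : ℝ) (m : ℕ) :
    0 < scaledCoeff p α a b m + scaledCoeff q α a b m := by
  rw [scaledCoeff_eq_mul p, scaledCoeff_eq_mul q, ← add_mul]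
  exact mul_pos hpq (scaledCoeff_one_pos hab α m)

theorem abs_scaledCoeff_sub_div_add {a b : ℝ} (hab : a < b) (p q α : ℝ) (m : ℕ) :
    |scaledCoeff p α a b m - scaledCoeff q α a b m| /
      (scaledCoeff p α a b m + scaledCoeff q α a b m) = |p - q| / (p + q) := by
  have hc := scaledCoeff_one_pos hab α m
  rw [scaledCoeff_eq_mul p, scaledCoeff_eq_mul q, ← sub_mul, ← add_mul, abs_mul, abs_of_pos hc,
    mul_div_mul_right _ _ hc.ne']

theorem systemMatrix_isSectorial (hα : ∀ i, 1 < α i ∧ α i ≤ 2) (hsum : ∀ i, 0 < dp i + dm i)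
    (hab : ∀ i, a i < b i) (hν : 0 ≤ ν) (hμ₀ : 0 ≤ μ)
    (hμ : ∀ i, |dp i - dm i| / (dp i + dm i) * |Real.tan (α i / 2 * Real.pi)| ≤ μ) :
    IsSectorial μ (systemMatrix ν α dp dm a b n) := by
  refine .add ((IsSectorial.of_posSemidef (PosSemidef.one.smul hν)).mono hμ₀)
    (.sum fun i _ => ?_)
  have h := IsSectorial.smul_add_smul_transpose
    (grunwaldMatrix_isSectorial (m := n i) (hα i).1 (hα i).2).axisMatrix
    (scaledCoeff_add_pos (hsum i) (hab i) (α i) (n i))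
  rw [abs_scaledCoeff_sub_div_add (hab i)] at h
  exact h.mono (hμ i)

theorem systemMatrix_form_bounds (hα : ∀ i, 1 ≤ α i ∧ α i ≤ 2) (hsum : ∀ i, 0 < dp i + dm i)
    (hab : ∀ i, a i < b i) (hν : 0 < ν) {u : Grid n → ℝ} (hu : u ≠ 0) :
    1 / 2 * (u ⬝ᵥ (tauPreconditioner ν α dp dm a b n *ᵥ u)) <
        u ⬝ᵥ (systemMatrix ν α dp dm a b n *ᵥ u) ∧
      u ⬝ᵥ (systemMatrix ν α dp dm a b n *ᵥ u) <
        3 / 2 * (u ⬝ᵥ (tauPreconditioner ν α dp dm a b n *ᵥ u)) := by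
  have hu0 : 0 < ν * (u ⬝ᵥ u) := mul_pos hν (by simpa using dotProduct_star_self_pos_iff.2 hu)
  have hc := fun i => (scaledCoeff_add_pos (hsum i) (hab i) (α i) (n i)).le
  have hτ := fun i => tauMatrix_grunwaldMatrix_form_bounds (m := n i) (hα i).1 (hα i).2
  have hτ' : ∀ i x, x ⬝ᵥ (tauMatrix (symPart (grunwaldMatrix (α i) (n i))) *ᵥ x) ≤
      2 * (x ⬝ᵥ (grunwaldMatrix (α i) (n i) *ᵥ x)) := fun i x => by linarith [hτ i x]
  have hlower := sum_le_sum fun i (_ : i ∈ univ) =>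
    mul_le_mul_of_nonneg_left (axisMatrix_form_le (hτ' i) u) (hc i)
  have hupper := sum_le_sum fun i (_ : i ∈ univ) =>
    mul_le_mul_of_nonneg_left (axisMatrix_form_le (fun x => (hτ i x).2) u) (hc i)
  simp only [mul_left_comm _ (2 : ℝ), mul_left_comm _ (3 / 2 : ℝ), ← mul_sum] at hlower hupper
  rw [systemMatrix_form_self, tauPreconditioner_form]
  constructor <;> linarith

theorem tauPreconditioner_posDef (hα : ∀ i, 1 ≤ α i ∧ α i ≤ 2) (hsum : ∀ i, 0 < dp i + dm i)
    (hab : ∀ i, a i < b i) (hν : 0 < ν) : (tauPreconditioner ν α dp dm a b n).PosDef := by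
  refine PosDef.of_dotProduct_mulVec_pos ?_ fun u hu => ?_
  · rw [Matrix.IsHermitian, conjTranspose_eq_transpose_of_trivial]
    exact tauPreconditioner_isSymm
  · rw [star_trivial]
    have h := systemMatrix_form_bounds hα hsum hab hν hu
    linarith

theorem abs_mem_Ioo_of_mem_spectrum_system (hα : ∀ i, 1 < α i ∧ α i ≤ 2)
    (hsum : ∀ i, 0 < dp i + dm i) (hab : ∀ i, a i < b i) (hν : 0 < ν) (hμ₀ : 0 ≤ μ)
    (hμ : ∀ i, |dp i - dm i| / (dp i + dm i) * |Real.tan (α i / 2 * Real.pi)| ≤ μ) {l : ℝ}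
    (hl : l ∈ spectrum ℝ ((tauPreconditioner ν α dp dm a b n)⁻¹ *
      (multiAntiIdentity n * systemMatrix ν α dp dm a b n))) :
    |l| ∈ Set.Ioo (1 / 2) (3 / 2 * √(1 + μ ^ 2)) := by
  have hα' := fun i => (hα i).imp_left le_of_lt
  have hP := tauPreconditioner_posDef (n := n) hα' hsum hab hν
  have hform := fun u hu => systemMatrix_form_bounds (n := n) (u := u) hα' hsum hab hν hu
  obtain ⟨x, hx, hlx⟩ := exists_mulVec_eq_smul_mulVec hP hl
  exact ⟨lt_abs_eigenvalue hP multiAntiIdentity_isSymm multiAntiIdentity_mul_self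
      multiAntiIdentity_mul_tauPreconditioner (hform x hx).1 hlx,
    abs_eigenvalue_lt (systemMatrix_isSectorial hα hsum hab hν.le hμ₀ hμ) hP
      multiAntiIdentity_isSymm multiAntiIdentity_mul_self multiAntiIdentity_mul_tauPreconditioner
      (fun u hu => (hform u hu).2) hx hlx⟩

end System

section Asymmetry

variable {d : ℕ} {α dp dm : Fin d → ℝ}

theorem le_asymmetry (i : Fin d) :
    |dp i - dm i| / (dp i + dm i) * |Real.tan (α i / 2 * Real.pi)| ≤ asymmetry α dp dm :=
  le_ciSup (f := fun i => |dp i - dm i| / (dp i + dm i) * |Real.tan (α i / 2 * Real.pi)|)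
    (Set.finite_range _).bddAbove i

theorem asymmetry_nonneg (hd : 1 ≤ d) (hsum : ∀ i, 0 < dp i + dm i) : 0 ≤ asymmetry α dp dm :=
  (mul_nonneg (div_nonneg (abs_nonneg _) (hsum _).le) (abs_nonneg _)).trans (le_asymmetry ⟨0, hd⟩)

end Asymmetry

section Rate

variable {ε μ : ℝ}

theorem rate_sq (hε : 0 ≤ ε) : rate ε ^ 2 = (2 + 3 * ε) / (4 + 3 * ε) :=
  Real.sq_sqrt (by positivity)

theorem rate_strictMonoOn : StrictMonoOn rate (Set.Ici 0) := by
  intro ε hε δ hδ h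
  rw [Set.mem_Ici] at hε hδ
  refine Real.sqrt_lt_sqrt (by positivity) ?_
  rw [div_lt_div_iff₀ (by positivity) (by positivity)]
  linarith

theorem rate_zero : rate 0 = √(1 / 2) := by
  norm_num [rate]

theorem rate_lt_one (hε : 0 ≤ ε) : rate ε < 1 := by
  rw [rate, Real.sqrt_lt' one_pos, one_pow, div_lt_one (by positivity)]
  linarith

theorem div_eq_rate_sq (hε : 0 ≤ ε) :
    (3 / 2 * (1 + ε) - 1 / 2) / (3 / 2 * (1 + ε) + 1 / 2) = rate ε ^ 2 := by
  rw [rate_sq hε, div_eq_div_iff (by positivity) (by positivity)]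
  ring

theorem exists_sqrt_one_add_sq_eq_one_add (hμ : 0 ≤ μ) :
    ∃ ε, 0 ≤ ε ∧ ((0 < ε ∧ ε < μ) ∨ (ε = 0 ∧ μ = 0)) ∧ √(1 + μ ^ 2) = 1 + ε := by
  rcases hμ.eq_or_lt with rfl | hμ
  · exact ⟨0, le_rfl, .inr ⟨rfl, rfl⟩, by norm_num⟩
  have hpos : 0 < √(1 + μ ^ 2) - 1 := by
    rw [sub_pos, Real.lt_sqrt zero_le_one, one_pow]
    exact lt_add_of_pos_right 1 (by positivity)
  have hlt : √(1 + μ ^ 2) - 1 < μ := by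
    rw [sub_lt_iff_lt_add, Real.sqrt_lt' (by positivity)]
    linarith [add_sq μ 1]
  exact ⟨_, hpos.le, .inl ⟨hpos, hlt⟩, (add_sub_cancel _ _).symm⟩

end Rate

theorem mem_Ioo_neg_union_Ioo_of_abs_mem {x y l : ℝ} (hl : |l| ∈ Set.Ioo x y) :
    l ∈ Set.Ioo (-y) (-x) ∪ Set.Ioo x y := by
  rcases lt_abs.1 hl.1 with h | h
  · exact .inr ⟨h, (abs_lt.1 hl.2).2⟩
  · exact .inl ⟨(abs_lt.1 hl.2).1, lt_neg_of_lt_neg h⟩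

end TauMinres

open TauMinres in
theorem mainTheorem2_general (d : ℕ) (hd : 1 ≤ d) (α dp dm : Fin d → ℝ)
    (hα : ∀ i, 1 < α i ∧ α i ≤ 2) (hsum : ∀ i, 0 < dp i + dm i) :
    ∃ ε : ℝ,
      ((0 < ε ∧ ε < asymmetry α dp dm) ∨
        (ε = 0 ∧ asymmetry α dp dm = 0)) ∧
      √(1 / 2) ≤ rate ε ∧ rate ε < 1 ∧
      (0 < ε → √(1 / 2) < rate ε) ∧
      ∀ (a b : Fin d → ℝ) (_hab : ∀ i, a i < b i) (τ : ℝ) (_hτ : 0 < τ) (n : Fin d → ℕ)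
        (A P Y : Matrix (Grid n) (Grid n) ℝ)
        (_hA : A = systemMatrix (1 / τ) α dp dm a b n)
        (_hP : P = tauPreconditioner (1 / τ) α dp dm a b n)
        (_hY : Y = multiAntiIdentity n),
        (Y * A).IsSymm ∧ P.PosDef ∧
        (∀ z ∈ spectrum ℂ ((P⁻¹ * (Y * A)).map (algebraMap ℝ ℂ)), ∃ x : ℝ, z = (x : ℂ) ∧
          x ∈ Set.Ioo (-(3 / 2 * (1 + ε))) (-(1 / 2)) ∪ Set.Ioo (1 / 2) (3 / 2 * (1 + ε))) ∧
        ∀ (rhs u₀ u : Grid n → ℝ) (k : ℕ),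
          IsMinresIterate (Y * A) P (Y *ᵥ rhs) u₀ k u →
          energyNorm P (precResidual (Y * A) P (Y *ᵥ rhs) u) ≤
            2 * rate ε ^ (2 * (k / 2)) *
              energyNorm P (precResidual (Y * A) P (Y *ᵥ rhs) u₀) := by
  have hμ := asymmetry_nonneg (α := α) hd hsum
  obtain ⟨ε, hε, hεμ, hsqrt⟩ := exists_sqrt_one_add_sq_eq_one_add hμ
  refine ⟨ε, hεμ, rate_zero ▸ rate_strictMonoOn.monotoneOn Set.self_mem_Ici hε hε, rate_lt_one hε,
    rate_zero ▸ rate_strictMonoOn Set.self_mem_Ici hε, ?_⟩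
  rintro a b hab τ hτ n A P Y rfl rfl rfl
  have hν : 0 < 1 / τ := one_div_pos.2 hτ
  have hM := multiAntiIdentity_mul_systemMatrix_isSymm (ν := 1 / τ) (α := α) (dp := dp)
    (dm := dm) (a := a) (b := b) (n := n)
  have hP := tauPreconditioner_posDef (n := n) (fun i => (hα i).imp_left le_of_lt) hsum hab hν
  have hspec := fun l =>
    abs_mem_Ioo_of_mem_spectrum_system (n := n) (l := l) hα hsum hab hν hμ le_asymmetry
  rw [hsqrt] at hspec
  refine ⟨hM, hP, fun z hz => ?_, fun rhs u₀ u k hu => ?_⟩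
  · rw [spectrum_complex_eq_image_ofReal hM hP] at hz
    obtain ⟨l, hl, rfl⟩ := hz
    exact ⟨l, rfl, mem_Ioo_neg_union_Ioo_of_abs_mem (hspec l hl)⟩
  · rw [pow_mul, ← div_eq_rate_sq hε]
    exact energyNorm_minres_le hM hP hu one_half_pos (by linarith)
      fun l hl => ⟨(hspec l hl).1.le, (hspec l hl).2.le⟩

theorem mainTheorem2 (d : ℕ) (hd : 1 ≤ d) (α dp dm : Fin d → ℝ)
    (hα : ∀ i, 1 < α i ∧ α i < 2) (hdp : ∀ i, 0 ≤ dp i) (hdm : ∀ i, 0 ≤ dm i)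
    (hsum : ∀ i, 0 < dp i + dm i) :
    ∃ ε : ℝ,
      ((0 < ε ∧ ε < TauMinres.asymmetry α dp dm) ∨
        (ε = 0 ∧ TauMinres.asymmetry α dp dm = 0)) ∧
      √(1 / 2) ≤ TauMinres.rate ε ∧ TauMinres.rate ε < 1 ∧
      (0 < ε → √(1 / 2) < TauMinres.rate ε) ∧
      ∀ (a b : Fin d → ℝ) (_hab : ∀ i, a i < b i) (τ : ℝ) (_hτ : 0 < τ)
        (n : Fin d → ℕ) (_hn : ∀ i, 1 ≤ n i)
        (A P Y : Matrix (TauMinres.Grid n) (TauMinres.Grid n) ℝ)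
        (_hA : A = TauMinres.systemMatrix (1 / τ) α dp dm a b n)
        (_hP : P = TauMinres.tauPreconditioner (1 / τ) α dp dm a b n)
        (_hY : Y = TauMinres.multiAntiIdentity n),
        (Y * A).IsSymm ∧ P.PosDef ∧
        (∀ z ∈ spectrum ℂ ((P⁻¹ * (Y * A)).map (algebraMap ℝ ℂ)), ∃ x : ℝ, z = (x : ℂ) ∧
          x ∈ Set.Ioo (-(3 / 2 * (1 + ε))) (-(1 / 2)) ∪ Set.Ioo (1 / 2) (3 / 2 * (1 + ε))) ∧
        ∀ (rhs u₀ u : TauMinres.Grid n → ℝ) (k : ℕ),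
          TauMinres.IsMinresIterate (Y * A) P (Y *ᵥ rhs) u₀ k u →
          TauMinres.energyNorm P (TauMinres.precResidual (Y * A) P (Y *ᵥ rhs) u) ≤
            2 * TauMinres.rate ε ^ (2 * (k / 2)) *
              TauMinres.energyNorm P (TauMinres.precResidual (Y * A) P (Y *ᵥ rhs) u₀) := by
  obtain ⟨ε, hε, hle, hlt, hlt', h⟩ :=
    mainTheorem2_general d hd α dp dm (fun i => ⟨(hα i).1, (hα i).2.le⟩) hsum
  exact ⟨ε, hε, hle, hlt, hlt', fun a b hab τ hτ n _ => h a b hab τ hτ n⟩
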